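/- Let $M$ be a compact connected Riemannian manifold without boundary and let $m\geq 1$. Let $H_1,\dots,H_m:T^*M\to\mathbb R$ be continuous functions such that, for every $i$, $p\mapsto H_i(x,p)$ is convex on $T_x^*M$ for every $x\in M$, and there are functions $\alpha_i,\beta_i:[0,+\infty)\to\mathbb R$, both tending to $+\infty$ at $+\infty$, with $\alpha_i(|p|)\leq H_i(x,p)\leq\beta_i(|p|)$ for all $(x,p)\in T^*M$. Let $B=(b_{ij})$ be a real $m\times m$ matrix with $b_{ij}\leq 0$ for $j\neq i$ and $\sum_{j} b_{ij}=0$ for every $i$, which is irreducible, i.e. for every nonempty $\mathcal I\subsetneq\{1,\dots,m\}$ there are $i\in\mathcal I$ and $j\notin\mathcal I$ with $b_{ij}\neq 0$. For $\lambda\geq 0$ and $c\in\mathbb R$ consider the system $$(B+\lambda\,\mathrm{Id})\mathbf u+\mathbb H(x,D\mathbf u)=c\,\mathbb 1\quad\text{in } M,\qquad\qquad (1)$$ where $\mathbb H(x,D\mathbf u)=(H_1(x,Du_1),\dots,H_m(x,Du_m))^T$ and $\mathbb 1=(1,\dots,1)^T$. Solutions are continuous functions $\mathbf u=(u_1,\dots,u_m)^T:M\to\mathbb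 R^m$ solving (1) in the viscosity sense: for all $x\in M$ and $i$, $H_i(x,p)+((B+\lambda\,\mathrm{Id})\mathbf u(x))_i$ is $\leq c$ for every $p$ in the superdifferential $D^+u_i(x)$ and $\geq c$ for every $p$ in the subdifferential $D^-u_i(x)$. There is a unique $c\in\mathbb R$, denoted by $c(\mathbb H)$, for which (1) with $\lambda=0$ has a solution. For all $\lambda>0$ and $c\in\mathbb R$, the system (1) has a unique solution $\mathbf u^{\lambda,c}$. As $\lambda\to 0^+$, the functions $\mathbf u^{\lambda,c(\mathbb H)}$ converge uniformly in $M$ to a solution $\mathbf u^0$ of (1) with $\lambda=0$ and $c=c(\mathbb H)$. Moreover, for every $c\in\mathbb R$, as $\lambda\to0^+$, the functions $\lambda\mathbf u^{\lambda,c}$ converge uniformly in $M$ to the constant vector $(c-c(\mathbb H))\mathbb 1$, and the functions $\mathbf u^{\lambda,c}-\big(\min_i\min_{x\in M}u_i^{\lambda,c}(x)\big)\mathbb 1$ converge uniformly in $M$ to $\mathbf u^0-\big(\min_i\min_{x\in M}u_i^0(x)\big)\mathbb 1$. -/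

import Mathlib

open Set Filter Topology Manifold Bundle
open scoped ContDiff

/-- The cotangent bundle `T*M` of an `n`-dimensional manifold `M`, a point of it being a pair
`⟨x, p⟩` with `p` a linear form on `T_x M`. It carries the topology of the vector bundle of
continuous linear maps from the tangent bundle to the trivial line bundle. -/
abbrev CotangentBundle (n : ℕ) (M : Type*) [TopologicalSpace M]
    [ChartedSpace (EuclideanSpace ℝ (Fin n)) M] : Type _ :=
  TotalSpace (EuclideanSpace ℝ (Fin n) →L[ℝ] ℝ) (fun x : M => TangentSpace (𝓡 n) x →L[ℝ] ℝ)

section Viscosity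

variable {n : ℕ} {M : Type*} [TopologicalSpace M] [ChartedSpace (EuclideanSpace ℝ (Fin n)) M]

/-- The superdifferential `D⁺u(x)`: differentials at `x` of the functions `φ` of class `C¹` near `x`
such that `u - φ` has a local maximum at `x`. -/
def superdifferential (n : ℕ) {M : Type*} [TopologicalSpace M]
    [ChartedSpace (EuclideanSpace ℝ (Fin n)) M] (u : M → ℝ) (x : M) :
    Set (TangentSpace (𝓡 n) x →L[ℝ] ℝ) :=
  {p | ∃ φ : M → ℝ, ContMDiffAt (𝓡 n) 𝓘(ℝ, ℝ) 1 φ x ∧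
    IsLocalMax (fun y => u y - φ y) x ∧ mfderiv (𝓡 n) 𝓘(ℝ, ℝ) φ x = p}

/-- The subdifferential `D⁻u(x)`: differentials at `x` of the functions `φ` of class `C¹` near `x`
such that `u - φ` has a local minimum at `x`. -/
def subdifferential (n : ℕ) {M : Type*} [TopologicalSpace M]
    [ChartedSpace (EuclideanSpace ℝ (Fin n)) M] (u : M → ℝ) (x : M) :
    Set (TangentSpace (𝓡 n) x →L[ℝ] ℝ) :=
  {p | ∃ φ : M → ℝ, ContMDiffAt (𝓡 n) 𝓘(ℝ, ℝ) 1 φ x ∧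
    IsLocalMin (fun y => u y - φ y) x ∧ mfderiv (𝓡 n) 𝓘(ℝ, ℝ) φ x = p}

/-- `u` is a (continuous) viscosity subsolution of `(B + l Id) u + H(x, Du) = c 1` in `M`. -/
def IsViscositySubsolution {m : ℕ} (H : Fin m → CotangentBundle n M → ℝ)
    (B : Matrix (Fin m) (Fin m) ℝ) (l c : ℝ) (u : M → Fin m → ℝ) : Prop :=
  Continuous u ∧ ∀ (x : M) (i : Fin m), ∀ p ∈ superdifferential n (fun y => u y i) x,
    H i ⟨x, p⟩ + ((B + l • (1 : Matrix (Fin m) (Fin m) ℝ)).mulVec (u x)) i ≤ c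

/-- `u` is a (continuous) viscosity supersolution of `(B + l Id) u + H(x, Du) = c 1` in `M`. -/
def IsViscositySupersolution {m : ℕ} (H : Fin m → CotangentBundle n M → ℝ)
    (B : Matrix (Fin m) (Fin m) ℝ) (l c : ℝ) (u : M → Fin m → ℝ) : Prop :=
  Continuous u ∧ ∀ (x : M) (i : Fin m), ∀ p ∈ subdifferential n (fun y => u y i) x,
    c ≤ H i ⟨x, p⟩ + ((B + l • (1 : Matrix (Fin m) (Fin m) ℝ)).mulVec (u x)) i

/-- `u` is a (continuous) viscosity solution of `(B + l Id) u + H(x, Du) = c 1` in `M`. -/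
def IsViscositySolution {m : ℕ} (H : Fin m → CotangentBundle n M → ℝ)
    (B : Matrix (Fin m) (Fin m) ℝ) (l c : ℝ) (u : M → Fin m → ℝ) : Prop :=
  IsViscositySubsolution H B l c u ∧ IsViscositySupersolution H B l c u

end Viscosity

/-- The normalization `u - (min_j min_y u_j(y)) 1`. On a nonempty compact space and for a continuous
`u` with `m ≥ 1` components, the infimum is a minimum. -/
noncomputable def normalizeMin {m : ℕ} {M : Type*} (u : M → Fin m → ℝ) : M → Fin m → ℝ :=
  fun x i => u x i - ⨅ j : Fin m, ⨅ y : M, u y j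

/-!
Why the discounted solutions converge.

*Comparison.* If `u` is a subsolution for the discount `l` and the right-hand side `c`, and `v` a
supersolution for `l` and `c'`, then `l (u - v) ≤ c - c'`: at a maximum point of `u_i - v_i` over
all `i` and `x`, the sign condition and the zero row sums make `B (u - v)` nonnegative in the `i`-th
component, and doubling the variables in a chart yields covectors, one in a superdifferential of
`u_i` and one in a subdifferential of `v_i`, which are close to each other and stay bounded by
coercivity (`le_of_isLocalMax_sub`, `mul_sub_le_of_sub_super`). For `l > 0` this gives uniqueness,
and for `l = 0` the uniqueness of the critical value.

*Existence.* For `l > 0` the supremum of the subsolutions above a constant is a solution (Perron's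
method, `exists_isViscositySolution`); coercivity makes this family equicontinuous, so that all
functions involved are continuous. For the critical problem, `l u^l` is bounded and hence `B u^l` is
bounded above, so by irreducibility the components of `u^l` stay at bounded distance from each other
(`exists_forall_sub_le_of_mulVec_le`); after subtraction of a constant the `u^l` are bounded and
equicontinuous, and a limit point solves the critical system (`exists_critical_solution`).

*Convergence.* At the critical right-hand side the solutions `u^l` are bounded, by comparison with
translates of a critical solution, and equicontinuous. Their limit point as `l → 0` is unique
because `l ↦ u^l` is approximately concave (`convex_comb_le_of_isViscositySolution`): if
`l = s l₁ + t l₂` with `s, t > 0` and `s + t = 1`, then by convexity of the Hamiltonians `s u^{l₁} + t u^{l₂}` is a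
subsolution for `l` up to the error
`s (l - l₁) (u^{l₁} - u^{l₂}) ≤ l ‖u^{l₁} - u^{l₂}‖`, so that comparison, which divides the error by
`l`, gives
`s u^{l₁} + t u^{l₂} ≤ u^l + ‖u^{l₁} - u^{l₂}‖`.
If `u^{l₁}` and `u^{l₂}` are both close to a limit point `f` and `u^l`, with `l₁ < l < l₂`, is close
to another limit point `g`, then `f ≤ g` (`le_of_mapClusterPt`); exchanging `f` and `g` gives
equality. No representation formula and no Mather measures are needed.

For a general right-hand side `c`, uniqueness gives `u^{l,c} = u^{l,c(H)} + (c - c(H)) / l`, from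
which the remaining limits follow.
-/

/-! ### Covectors and semidifferentials in a chart -/

section Coordinates

variable {n : ℕ} {M : Type*} [TopologicalSpace M] [ChartedSpace (EuclideanSpace ℝ (Fin n)) M]

theorem tendsto_extChartAt_symm (x₀ : M) :
    Tendsto (extChartAt (𝓡 n) x₀).symm (𝓝 (extChartAt (𝓡 n) x₀ x₀)) (𝓝 x₀) := by
  have := continuousAt_extChartAt_symm (I := 𝓡 n) x₀
  rwa [ContinuousAt, extChartAt_to_inv] at this

theorem extChartAt_target_mem_nhds_of_mem {x₀ : M} {y : EuclideanSpace ℝ (Fin n)}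
    (hy : y ∈ (extChartAt (𝓡 n) x₀).target) : (extChartAt (𝓡 n) x₀).target ∈ 𝓝 y :=
  (isOpen_extChartAt_target x₀).mem_nhds hy

variable [IsManifold (𝓡 n) ∞ M]

/-- The covector at `e.symm y` whose expression in the chart `e` centred at `x₀` is `q`. The
identification of the tangent space with `ℝⁿ` is the trivialization of the tangent bundle at `x₀`,
which over the domain of the chart is the derivative of `e`. Outside the target of `e` this is a
junk value. -/
noncomputable def coordCovector (x₀ : M) (y : EuclideanSpace ℝ (Fin n))
    (q : EuclideanSpace ℝ (Fin n) →L[ℝ] ℝ) :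
    TangentSpace (𝓡 n) ((extChartAt (𝓡 n) x₀).symm y) →L[ℝ] ℝ :=
  q ∘L (trivializationAt (EuclideanSpace ℝ (Fin n)) (TangentSpace (𝓡 n) : M → Type _)
      x₀).continuousLinearMapAt ℝ ((extChartAt (𝓡 n) x₀).symm y)

/-- The point of `T*M` with coordinates `(y, q)` in the chart centred at `x₀`; meaningful for `y` in
the target of the chart. -/
noncomputable def ofCoord (x₀ : M) (y : EuclideanSpace ℝ (Fin n))
    (q : EuclideanSpace ℝ (Fin n) →L[ℝ] ℝ) : CotangentBundle n M :=
  ⟨(extChartAt (𝓡 n) x₀).symm y, coordCovector x₀ y q⟩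

theorem coordCovector_neg (x₀ : M) (y : EuclideanSpace ℝ (Fin n))
    (q : EuclideanSpace ℝ (Fin n) →L[ℝ] ℝ) :
    coordCovector x₀ y (-q) = -coordCovector x₀ y q :=
  ContinuousLinearMap.neg_comp _ _

theorem mfderiv_comp_extChartAt {x₀ : M} {y : EuclideanSpace ℝ (Fin n)}
    (hy : y ∈ (extChartAt (𝓡 n) x₀).target) {φ : EuclideanSpace ℝ (Fin n) → ℝ}
    (hφ : DifferentiableAt ℝ φ y) :
    mfderiv (𝓡 n) 𝓘(ℝ, ℝ) (φ ∘ extChartAt (𝓡 n) x₀) ((extChartAt (𝓡 n) x₀).symm y) =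
      coordCovector x₀ y (fderiv ℝ φ y) := by
  have hs := (extChartAt (𝓡 n) x₀).map_target hy
  rw [extChartAt_source] at hs
  have h1 : MDifferentiableAt 𝓘(ℝ, EuclideanSpace ℝ (Fin n)) 𝓘(ℝ, ℝ) φ
      (extChartAt (𝓡 n) x₀ ((extChartAt (𝓡 n) x₀).symm y)) := by
    rw [(extChartAt (𝓡 n) x₀).right_inv hy]
    exact hφ.mdifferentiableAt
  rw [mfderiv_comp _ h1 (mdifferentiableAt_extChartAt hs)]
  simp only [coordCovector, TangentBundle.continuousLinearMapAt_trivializationAt hs]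
  rw [mfderiv_eq_fderiv, (extChartAt (𝓡 n) x₀).right_inv hy]
  rfl

theorem trivializationAt_ofCoord {x₀ : M} {y : EuclideanSpace ℝ (Fin n)}
    (hy : y ∈ (extChartAt (𝓡 n) x₀).target) (q : EuclideanSpace ℝ (Fin n) →L[ℝ] ℝ) :
    trivializationAt (EuclideanSpace ℝ (Fin n) →L[ℝ] ℝ)
      (fun x : M => TangentSpace (𝓡 n) x →L[ℝ] ℝ) x₀ (ofCoord x₀ y q) =
      ((extChartAt (𝓡 n) x₀).symm y, q) := by
  have hs := (extChartAt (𝓡 n) x₀).map_target hy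
  rw [extChartAt_source] at hs
  rw [hom_trivializationAt_apply]
  refine Prod.ext rfl ?_
  ext v
  have hb : (extChartAt (𝓡 n) x₀).symm y ∈ (trivializationAt (EuclideanSpace ℝ (Fin n))
      (TangentSpace (𝓡 n) : M → Type _) x₀).baseSet := hs
  simp only [ContinuousLinearMap.inCoordinates, ofCoord, coordCovector,
    ContinuousLinearMap.comp_apply, Trivialization.continuousLinearMapAt_symmL _ hb]
  simp
/-- The coordinates `(y, q)` are compatible with the topology of the cotangent bundle, since
`ofCoord` is the inverse of its trivialization at `x₀` (`trivializationAt_ofCoord`). -/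
theorem continuousAt_ofCoord {x₀ : M} {y : EuclideanSpace ℝ (Fin n)}
    (hy : y ∈ (extChartAt (𝓡 n) x₀).target) (q : EuclideanSpace ℝ (Fin n) →L[ℝ] ℝ) :
    ContinuousAt (fun z : EuclideanSpace ℝ (Fin n) × (EuclideanSpace ℝ (Fin n) →L[ℝ] ℝ) =>
      ofCoord (M := M) x₀ z.1 z.2) (y, q) := by
  set T := trivializationAt (EuclideanSpace ℝ (Fin n) →L[ℝ] ℝ)
    (fun x : M => TangentSpace (𝓡 n) x →L[ℝ] ℝ) x₀ with hT
  have hs := (extChartAt (𝓡 n) x₀).map_target hy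
  rw [extChartAt_source] at hs
  have hsrc : ofCoord x₀ y q ∈ T.source := by
    rw [hT, hom_trivializationAt_source]
    exact ⟨hs, mem_univ _⟩
  have hcont : ContinuousAt
      (fun z : EuclideanSpace ℝ (Fin n) × (EuclideanSpace ℝ (Fin n) →L[ℝ] ℝ) =>
      ((extChartAt (𝓡 n) x₀).symm z.1, z.2)) (y, q) :=
    (ContinuousAt.comp (f := Prod.fst) (x := (y, q)) (continuousAt_extChartAt_symm'' hy)
      continuousAt_fst).prodMk continuousAt_snd
  unfold ContinuousAt
  rw [T.tendsto_nhds_iff hsrc]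
  have hev : ∀ᶠ z : EuclideanSpace ℝ (Fin n) × (EuclideanSpace ℝ (Fin n) →L[ℝ] ℝ) in 𝓝 (y, q),
      z.1 ∈ (extChartAt (𝓡 n) x₀).target :=
    continuousAt_fst.eventually (extChartAt_target_mem_nhds_of_mem hy)
  refine ⟨hcont.fst, ?_⟩
  rw [trivializationAt_ofCoord hy]
  refine (continuousAt_snd (p := (y, q))).tendsto.congr' ?_
  filter_upwards [hev] with z hz
  rw [hT, trivializationAt_ofCoord hz]

/-- A `C¹` function touching `u` from above in a chart gives an element of the superdifferential. -/
theorem mem_superdifferential_of_coord {u : M → ℝ} {x₀ : M} {y : EuclideanSpace ℝ (Fin n)}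
    (hy : y ∈ (extChartAt (𝓡 n) x₀).target) {φ : EuclideanSpace ℝ (Fin n) → ℝ}
    (hφ : ContDiffAt ℝ 1 φ y)
    (hmax : IsLocalMax (fun z => u ((extChartAt (𝓡 n) x₀).symm z) - φ z) y) :
    coordCovector x₀ y (fderiv ℝ φ y) ∈
      superdifferential n u ((extChartAt (𝓡 n) x₀).symm y) := by
  have hs := (extChartAt (𝓡 n) x₀).map_target hy
  have hright := (extChartAt (𝓡 n) x₀).right_inv hy
  refine ⟨φ ∘ extChartAt (𝓡 n) x₀, ?_, ?_,
    mfderiv_comp_extChartAt hy (hφ.differentiableAt one_ne_zero)⟩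
  · refine ContMDiffAt.comp (I' := 𝓘(ℝ, EuclideanSpace ℝ (Fin n))) _ ?_ ?_
    · rw [hright]
      exact hφ.contMDiffAt
    · exact (contMDiffAt_extChartAt' (n := ∞) (by rwa [extChartAt_source] at hs)).of_le
        (by exact_mod_cast le_top)
  · have hc : Tendsto (extChartAt (𝓡 n) x₀) (𝓝 ((extChartAt (𝓡 n) x₀).symm y)) (𝓝 y) := by
      have := continuousAt_extChartAt' hs
      rwa [ContinuousAt, hright] at this
    filter_upwards [hc.eventually hmax, extChartAt_source_mem_nhds' hs] with z hz hzs
    simpa only [Function.comp_apply, hright, (extChartAt (𝓡 n) x₀).left_inv hzs] using hz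

/-- Every element of the superdifferential at `x₀` comes from a test function in the chart centred
at `x₀`. -/
theorem exists_coord_of_mem_superdifferential {u : M → ℝ} {x₀ : M}
    {p : TangentSpace (𝓡 n) x₀ →L[ℝ] ℝ} (hp : p ∈ superdifferential n u x₀) :
    ∃ φ : EuclideanSpace ℝ (Fin n) → ℝ, ContDiffAt ℝ 1 φ (extChartAt (𝓡 n) x₀ x₀) ∧
      IsLocalMax (fun z => u ((extChartAt (𝓡 n) x₀).symm z) - φ z) (extChartAt (𝓡 n) x₀ x₀) ∧
      ofCoord x₀ (extChartAt (𝓡 n) x₀ x₀) (fderiv ℝ φ (extChartAt (𝓡 n) x₀ x₀)) = ⟨x₀, p⟩ := by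
  obtain ⟨φ, hφ, hmax, rfl⟩ := hp
  have hφ' : ContDiffAt ℝ 1 (φ ∘ (extChartAt (𝓡 n) x₀).symm) (extChartAt (𝓡 n) x₀ x₀) := by
    have := (contMDiffAt_iff.1 hφ).2
    simpa only [extChartAt_model_space_eq_id, PartialEquiv.refl_coe, Function.id_comp,
      ModelWithCorners.range_eq_univ, contDiffWithinAt_univ, writtenInExtChartAt] using this
  have hy := mem_extChartAt_target (I := 𝓡 n) x₀
  have hleft := extChartAt_to_inv (I := 𝓡 n) x₀
  refine ⟨φ ∘ (extChartAt (𝓡 n) x₀).symm, hφ', ?_, ?_⟩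
  · filter_upwards [(tendsto_extChartAt_symm (n := n) x₀).eventually hmax] with z hz
    simpa only [Function.comp_apply, hleft] using hz
  · have key := mfderiv_comp_extChartAt hy (hφ'.differentiableAt one_ne_zero)
    have heq : (φ ∘ (extChartAt (𝓡 n) x₀).symm) ∘ extChartAt (𝓡 n) x₀ =ᶠ[𝓝 x₀] φ := by
      filter_upwards [extChartAt_source_mem_nhds (I := 𝓡 n) x₀] with z hz
      simp only [Function.comp_apply, (extChartAt (𝓡 n) x₀).left_inv hz]
    have h2 : ofCoord x₀ (extChartAt (𝓡 n) x₀ x₀)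
        (fderiv ℝ (φ ∘ (extChartAt (𝓡 n) x₀).symm) (extChartAt (𝓡 n) x₀ x₀)) =
        (⟨(extChartAt (𝓡 n) x₀).symm (extChartAt (𝓡 n) x₀ x₀), mfderiv (𝓡 n) 𝓘(ℝ, ℝ)
          ((φ ∘ (extChartAt (𝓡 n) x₀).symm) ∘ extChartAt (𝓡 n) x₀)
          ((extChartAt (𝓡 n) x₀).symm (extChartAt (𝓡 n) x₀ x₀))⟩ : CotangentBundle n M) := by
      rw [key]; rfl
    rw [h2, hleft, heq.mfderiv_eq]

omit [IsManifold (𝓡 n) ∞ M] in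
theorem mem_subdifferential_iff_neg {u : M → ℝ} {x : M} {p : TangentSpace (𝓡 n) x →L[ℝ] ℝ} :
    p ∈ subdifferential n u x ↔ -p ∈ superdifferential n (fun y => -u y) x := by
  constructor
  · rintro ⟨φ, hφ, hmin, rfl⟩
    refine ⟨fun y => -φ y, hφ.neg, ?_, mfderiv_neg⟩
    filter_upwards [hmin] with y hy
    linarith
  · rintro ⟨φ, hφ, hmax, h⟩
    refine ⟨fun y => -φ y, hφ.neg, ?_, ?_⟩
    · filter_upwards [hmax] with y hy
      linarith
    · have := mfderiv_neg (I := 𝓡 n) (f := φ) (x := x)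
      exact this.trans (by rw [h]; exact neg_neg p)

theorem mem_subdifferential_of_coord {u : M → ℝ} {x₀ : M} {y : EuclideanSpace ℝ (Fin n)}
    (hy : y ∈ (extChartAt (𝓡 n) x₀).target) {φ : EuclideanSpace ℝ (Fin n) → ℝ}
    (hφ : ContDiffAt ℝ 1 φ y)
    (hmin : IsLocalMin (fun z => u ((extChartAt (𝓡 n) x₀).symm z) - φ z) y) :
    coordCovector x₀ y (fderiv ℝ φ y) ∈
      subdifferential n u ((extChartAt (𝓡 n) x₀).symm y) := by
  rw [mem_subdifferential_iff_neg]
  have := mem_superdifferential_of_coord (u := fun x => -u x) hy hφ.neg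
    (by filter_upwards [hmin] with z hz; linarith)
  rwa [show fderiv ℝ (fun z => -φ z) y = -fderiv ℝ φ y from fderiv_neg, coordCovector_neg] at this

theorem coordCovector_comp_symmL {x₀ : M} {y : EuclideanSpace ℝ (Fin n)}
    (hy : y ∈ (extChartAt (𝓡 n) x₀).target) (q : EuclideanSpace ℝ (Fin n) →L[ℝ] ℝ) :
    q = coordCovector x₀ y q ∘L
      (trivializationAt (EuclideanSpace ℝ (Fin n)) (TangentSpace (𝓡 n) : M → Type _)
      x₀).symmL ℝ ((extChartAt (𝓡 n) x₀).symm y) := by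
  have hs := (extChartAt (𝓡 n) x₀).map_target hy
  rw [extChartAt_source] at hs
  have hb : (extChartAt (𝓡 n) x₀).symm y ∈ (trivializationAt (EuclideanSpace ℝ (Fin n))
      (TangentSpace (𝓡 n) : M → Type _) x₀).baseSet := hs
  ext v
  exact congrArg q (Trivialization.continuousLinearMapAt_symmL _ hb v).symm

variable [RiemannianBundle (fun x : M => TangentSpace (𝓡 n) x)]
  [IsContMDiffRiemannianBundle (𝓡 n) ∞ (EuclideanSpace ℝ (Fin n))
      (fun x : M => TangentSpace (𝓡 n) x)]

/-- The Euclidean norm of the coordinates of a covector is controlled by its Riemannian norm,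
locally uniformly in the base point. -/
theorem eventually_norm_le_norm_coordCovector (x₀ : M) :
    ∃ K > 0, ∀ᶠ y in 𝓝 (extChartAt (𝓡 n) x₀ x₀), ∀ q,
      ‖q‖ ≤ ‖coordCovector (n := n) (M := M) x₀ y q‖ * K := by
  have : IsContinuousRiemannianBundle (EuclideanSpace ℝ (Fin n))
      (fun x : M => TangentSpace (𝓡 n) x) := by
    obtain ⟨g, hg, h⟩ := IsContMDiffRiemannianBundle.exists_contMDiff (IB := 𝓡 n) (n := ∞)
      (F := EuclideanSpace ℝ (Fin n)) (E := fun x : M => TangentSpace (𝓡 n) x)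
    exact ⟨g, hg.continuous, h⟩
  obtain ⟨K, hK, h⟩ := eventually_norm_symmL_trivializationAt_lt (EuclideanSpace ℝ (Fin n))
      (fun x : M => TangentSpace (𝓡 n) x) x₀
  refine ⟨K, hK, ?_⟩
  filter_upwards [(tendsto_extChartAt_symm (n := n) x₀).eventually h,
    extChartAt_target_mem_nhds (I := 𝓡 n) x₀] with y hy hyt q
  conv_lhs => rw [coordCovector_comp_symmL hyt q]
  exact (ContinuousLinearMap.opNorm_comp_le _ _).trans
    (mul_le_mul_of_nonneg_left hy.le (norm_nonneg _))

end Coordinates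

/-! ### Test functions in Euclidean space -/

section Euclidean

open Metric

variable {E : Type*} [NormedAddCommGroup E] [InnerProductSpace ℝ E]

theorem hasFDerivAt_const_mul_norm_sub_sq (k : ℝ) (b a : E) :
    HasFDerivAt (fun y : E => k * ‖y - b‖ ^ 2) ((2 * k) • innerSL ℝ (a - b)) a := by
  have h := (((hasFDerivAt_id (𝕜 := ℝ) a).sub_const b).norm_sq).const_mul k
  refine h.congr_fderiv ?_
  ext v
  simp
  ring

theorem contDiff_const_mul_norm_sub_sq (k : ℝ) (b : E) :
    ContDiff ℝ 1 (fun y : E => k * ‖y - b‖ ^ 2) :=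
  contDiff_const.mul ((contDiff_id.sub contDiff_const).norm_sq ℝ)

variable [ProperSpace E]

/-- Doubling of variables: at a maximum point `y₀` of `f - g` there are a `C¹` function touching `f`
from above and one touching `g` from below, at points close to `y₀` and with gradients close to each
other. -/
theorem exists_test_pair {f g : E → ℝ} {y₀ : E} {r : ℝ} (hr : 0 < r)
    (hf : ContinuousOn f (closedBall y₀ r)) (hg : ContinuousOn g (closedBall y₀ r))
    (hmax : ∀ y ∈ closedBall y₀ r, f y - g y ≤ f y₀ - g y₀) {ε : ℝ} (hε : 0 < ε) :
    ∃ a ∈ ball y₀ ε, ∃ b ∈ ball y₀ ε, ∃ φ χ : E → ℝ, ContDiff ℝ 1 φ ∧ ContDiff ℝ 1 χ ∧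
      IsLocalMax (fun y => f y - φ y) a ∧ IsLocalMin (fun y => g y - χ y) b ∧
      ‖fderiv ℝ φ a - fderiv ℝ χ b‖ < ε := by
  have hK : IsCompact (closedBall y₀ r) := isCompact_closedBall y₀ r
  have hy₀ : y₀ ∈ closedBall y₀ r := mem_closedBall_self hr.le
  obtain ⟨δ, hδ, hδε, hδr⟩ : ∃ δ > 0, 2 * δ < ε ∧ 2 * δ < r := by
    refine ⟨min ε r / 4, by positivity, ?_, ?_⟩
    · have := min_le_left ε r; linarith
    · have := min_le_right ε r; linarith
  obtain ⟨η, hη, hfη⟩ := Metric.uniformContinuousOn_iff.1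
    (hK.uniformContinuousOn_of_continuous hf) (δ ^ 2) (by positivity)
  obtain ⟨D₁, hD₁⟩ := hK.exists_bound_of_continuousOn hf
  obtain ⟨D₂, hD₂⟩ := hK.exists_bound_of_continuousOn hg
  -- the penalization `k ‖a - b‖²` is so strong that `a` and `b` are within the modulus of
  -- continuity of `f`, and `‖b - y₀‖²` localizes the maximum of the doubled function at `y₀`
  set D := 2 * D₁ + 2 * D₂ + 1 with hD
  have hD0 : 0 < D := by
    have h1 := (norm_nonneg _).trans (hD₁ y₀ hy₀)
    have h2 := (norm_nonneg _).trans (hD₂ y₀ hy₀)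
    positivity
  set s := min η δ with hs
  have hs0 : 0 < s := lt_min hη hδ
  set k := D / s ^ 2 with hk
  have hk0 : 0 < k := by positivity
  obtain ⟨⟨a, b⟩, ⟨ha, hb⟩, hab⟩ := (hK.prod hK).exists_isMaxOn ⟨(y₀, y₀), hy₀, hy₀⟩
    (f := fun z : E × E => f z.1 - g z.2 - k * ‖z.1 - z.2‖ ^ 2 - ‖z.2 - y₀‖ ^ 2) (by
      refine ((ContinuousOn.sub ?_ ?_).sub ?_).sub ?_
      · exact hf.comp continuousOn_fst fun z hz => hz.1
      · exact hg.comp continuousOn_snd fun z hz => hz.2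
      · fun_prop
      · fun_prop)
  have hab' : ∀ a' ∈ closedBall y₀ r, ∀ b' ∈ closedBall y₀ r,
      f a' - g b' - k * ‖a' - b'‖ ^ 2 - ‖b' - y₀‖ ^ 2 ≤
        f a - g b - k * ‖a - b‖ ^ 2 - ‖b - y₀‖ ^ 2 := fun a' ha' b' hb' =>
    hab (a := (a', b')) ⟨ha', hb'⟩
  have h0 := hab' y₀ hy₀ y₀ hy₀
  simp only [sub_self, norm_zero] at h0
  have hfa := abs_le.1 (hD₁ a ha)
  have hgb := abs_le.1 (hD₂ b hb)
  have hf0 := abs_le.1 (hD₁ y₀ hy₀)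
  have hg0 := abs_le.1 (hD₂ y₀ hy₀)
  have hlt : ‖a - b‖ < s := by
    have h1 : k * ‖a - b‖ ^ 2 < D := by
      have := sq_nonneg ‖b - y₀‖
      simp only [hD]; linarith
    have h2 : k * ‖a - b‖ ^ 2 < k * s ^ 2 := by
      rwa [hk, div_mul_cancel₀ _ (by positivity)]
    exact lt_of_pow_lt_pow_left₀ 2 hs0.le (lt_of_mul_lt_mul_left h2 hk0.le)
  have hby : ‖b - y₀‖ < δ := by
    have h1 := hfη a ha b hb (by rw [dist_eq_norm]; exact hlt.trans_le (min_le_left _ _))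
    rw [Real.dist_eq] at h1
    have h2 := (abs_lt.1 h1).2
    have h3 := hmax b hb
    have h4 : 0 ≤ k * ‖a - b‖ ^ 2 := by positivity
    exact lt_of_pow_lt_pow_left₀ 2 hδ.le (by linarith)
  have hay : ‖a - y₀‖ < 2 * δ := by
    calc ‖a - y₀‖ = ‖(a - b) + (b - y₀)‖ := by congr 1; abel
      _ ≤ ‖a - b‖ + ‖b - y₀‖ := norm_add_le _ _
      _ < 2 * δ := by have := hlt.trans_le (min_le_right η δ); linarith
  have hder : HasFDerivAt (fun y : E => -k * ‖y - a‖ ^ 2 + -1 * ‖y - y₀‖ ^ 2)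
      ((2 * -k) • innerSL ℝ (b - a) + (2 * (-1 : ℝ)) • innerSL ℝ (b - y₀)) b :=
    (hasFDerivAt_const_mul_norm_sub_sq (-k) a b).add (hasFDerivAt_const_mul_norm_sub_sq (-1) y₀ b)
  refine ⟨a, by rw [mem_ball, dist_eq_norm]; linarith, b,
    by rw [mem_ball, dist_eq_norm]; linarith, fun y => k * ‖y - b‖ ^ 2,
    fun y => -k * ‖y - a‖ ^ 2 + -1 * ‖y - y₀‖ ^ 2, contDiff_const_mul_norm_sub_sq _ _,
    (contDiff_const_mul_norm_sub_sq _ _).add (contDiff_const_mul_norm_sub_sq _ _), ?_, ?_, ?_⟩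
  · have hnhds : closedBall y₀ r ∈ 𝓝 a :=
      mem_of_superset (isOpen_ball.mem_nhds (by rw [mem_ball, dist_eq_norm]; linarith))
        ball_subset_closedBall
    filter_upwards [hnhds] with y hy
    have := hab' y hy b hb
    linarith
  · have hnhds : closedBall y₀ r ∈ 𝓝 b :=
      mem_of_superset (isOpen_ball.mem_nhds (by rw [mem_ball, dist_eq_norm]; linarith))
        ball_subset_closedBall
    filter_upwards [hnhds] with y hy
    have := hab' a ha y hy
    rw [norm_sub_rev a y, norm_sub_rev a b] at this
    linarith
  · rw [(hasFDerivAt_const_mul_norm_sub_sq k b a).fderiv, hder.fderiv]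
    have : (2 * k) • innerSL ℝ (a - b) -
        ((2 * -k) • innerSL ℝ (b - a) + (2 * (-1 : ℝ)) • innerSL ℝ (b - y₀)) =
        (2 : ℝ) • innerSL ℝ (b - y₀) := by
      ext v
      simp
      ring
    rw [this, norm_smul, innerSL_apply_norm]
    norm_num
    linarith

/-- A bound on the gradients of the functions touching `f` from above makes `f` Lipschitz. The proof
compares `f - f y` with a radial barrier that is steeper than `R` and exceeds the oscillation of `f`
near the sphere of radius `ρ`: the maximum of the difference can only be at the centre. -/
theorem sub_le_of_forall_test_norm_le {f : E → ℝ} {y : E} {ρ R : ℝ} (hρ : 0 < ρ) (hR : 0 ≤ R)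
    (hf : ContinuousOn f (closedBall y ρ))
    (htest : ∀ z ∈ ball y ρ, ∀ φ : E → ℝ, ContDiffAt ℝ 1 φ z →
      IsLocalMax (fun w => f w - φ w) z → ‖fderiv ℝ φ z‖ ≤ R) {z : E}
    (hz : z ∈ closedBall y (ρ / 2)) :
    f z - f y ≤ 2 * (R + 1) * ‖z - y‖ := by
  set K := R + 1 with hKdef
  have hK : 0 < K := by positivity
  obtain ⟨D₀, hD₀⟩ := (isCompact_closedBall y ρ).exists_bound_of_continuousOn hf
  have hyy : y ∈ closedBall y ρ := mem_closedBall_self hρ.le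
  set D := 2 * D₀ with hD
  have hD0 : 0 ≤ D := by have := (norm_nonneg _).trans (hD₀ y hyy); positivity
  -- the radial profile `g` of the barrier has slope at least `K` and blows up at `ρ`
  set g : ℝ → ℝ := fun t => K * ρ * t / (ρ - t) with hg
  have hgder : ∀ t < ρ, HasDerivAt g (K * ρ ^ 2 / (ρ - t) ^ 2) t := by
    intro t ht
    have hne : ρ - t ≠ 0 := by linarith
    have := ((hasDerivAt_id t).const_mul (K * ρ)).div ((hasDerivAt_id t).const_sub ρ) hne
    refine this.congr_deriv ?_
    simp only [id]
    field_simp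
    ring
  set h : E → ℝ := fun w => g ‖w - y‖ with hh
  have hzρ : ‖z - y‖ ≤ ρ / 2 := by rwa [mem_closedBall, dist_eq_norm] at hz
  have hhz : h z ≤ 2 * K * ‖z - y‖ := by
    simp only [hh, hg]
    rw [div_le_iff₀ (by linarith)]
    have := mul_nonneg hK.le (norm_nonneg (z - y))
    nlinarith
  refine le_trans ?_ hhz
  by_contra! hcon
  -- the radius `s = ρ (1 - τ)` is so close to `ρ` that the barrier exceeds `D` on its sphere
  set τ := K * ρ / (2 * (K * ρ + D)) with hτ
  have hKρ : 0 < K * ρ := by positivity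
  have hτ0 : 0 < τ := by positivity
  have hτ1 : τ ≤ 1 / 2 := by
    rw [hτ, div_le_div_iff₀ (by positivity) (by norm_num)]
    linarith
  set s := ρ * (1 - τ) with hs
  have hsρ : s < ρ := by rw [hs]; nlinarith
  have hs2 : ρ / 2 ≤ s := by rw [hs]; nlinarith
  have hgs : D < g s := by
    have h1 : g s = K * ρ * (1 - τ) / τ := by
      simp only [hg, hs]
      rw [show ρ - ρ * (1 - τ) = ρ * τ by ring]
      field_simp
    rw [h1, lt_div_iff₀ hτ0]
    have h2 : τ * (2 * (K * ρ + D)) = K * ρ := by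
      rw [hτ]; field_simp
    nlinarith
  have hss : closedBall y s ⊆ closedBall y ρ := closedBall_subset_closedBall hsρ.le
  have hhcont : ContinuousOn h (closedBall y s) := by
    simp only [hh, hg]
    refine ContinuousOn.div (by fun_prop) (by fun_prop) fun w hw => ?_
    rw [mem_closedBall, dist_eq_norm] at hw
    linarith
  obtain ⟨w, hw, hwmax⟩ := (isCompact_closedBall y s).exists_isMaxOn
    ⟨y, mem_closedBall_self (by linarith)⟩ ((hf.mono hss).sub hhcont)
  have hwmax' : ∀ w' ∈ closedBall y s, f w' - h w' ≤ f w - h w := fun w' hw' => hwmax hw'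
  have hzs : z ∈ closedBall y s := by rw [mem_closedBall, dist_eq_norm]; linarith
  have h1 := hwmax' z hzs
  have hhy : h y = 0 := by simp [hh, hg]
  have hwy : w ≠ y := by
    rintro rfl
    linarith
  have hwpos : 0 < ‖w - y‖ := norm_pos_iff.2 (sub_ne_zero.2 hwy)
  have hws : ‖w - y‖ < s := by
    rw [mem_closedBall, dist_eq_norm] at hw
    refine lt_of_le_of_ne hw fun heq => ?_
    have h2 : h w = g s := by simp only [hh, heq]
    have h3 := abs_le.1 (hD₀ w (hss (by rw [mem_closedBall, dist_eq_norm]; exact hw)))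
    have h4 := abs_le.1 (hD₀ y hyy)
    linarith
  have hloc : IsLocalMax (fun w' => f w' - h w') w := by
    filter_upwards [isOpen_ball.mem_nhds (show w ∈ ball y s by rwa [mem_ball, dist_eq_norm])]
      with w' hw'
    exact hwmax' w' (ball_subset_closedBall hw')
  have hsub : ContDiffAt ℝ 1 (fun w' : E => ‖w' - y‖) w :=
    (contDiffAt_id.sub contDiffAt_const).norm ℝ (sub_ne_zero.2 hwy)
  have hhC : ContDiffAt ℝ 1 h w := by
    simp only [hh, hg]
    exact (contDiffAt_const.mul hsub).div (contDiffAt_const.sub hsub) (by linarith)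
  have hle := htest w (by rw [mem_ball, dist_eq_norm]; linarith) h hhC hloc
  have hN : HasFDerivAt (fun w' : E => ‖w' - y‖) (fderiv ℝ (fun x : E => ‖x‖) (w - y)) w := by
    have h5 : DifferentiableAt ℝ (fun x : E => ‖x‖) (w - y) :=
      (contDiffAt_norm ℝ (sub_ne_zero.2 hwy)).differentiableAt (n := 1) one_ne_zero
    have := h5.hasFDerivAt.comp w ((hasFDerivAt_id (𝕜 := ℝ) w).sub_const y)
    simpa only [id, ContinuousLinearMap.comp_id, Function.comp_def] using this
  have hder : HasFDerivAt h ((K * ρ ^ 2 / (ρ - ‖w - y‖) ^ 2) •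
      fderiv ℝ (fun x : E => ‖x‖) (w - y)) w :=
    (hgder _ (by linarith)).comp_hasFDerivAt w hN
  have hval : fderiv ℝ h w (w - y) = K * ρ ^ 2 / (ρ - ‖w - y‖) ^ 2 * ‖w - y‖ := by
    rw [hder.fderiv]
    have := ((contDiffAt_norm (n := 1) ℝ (sub_ne_zero.2 hwy)).differentiableAt
      one_ne_zero).fderiv_norm_self
    simp [this]
  have h6 := (fderiv ℝ h w).le_opNorm (w - y)
  rw [hval, Real.norm_eq_abs] at h6
  have h7 : K ≤ K * ρ ^ 2 / (ρ - ‖w - y‖) ^ 2 := by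
    rw [le_div_iff₀ (by have : 0 < ρ - ‖w - y‖ := by linarith
                        positivity)]
    have : (ρ - ‖w - y‖) ^ 2 ≤ ρ ^ 2 := pow_le_pow_left₀ (by linarith) (by linarith) 2
    nlinarith
  have h8 := (le_abs_self _).trans h6
  have h9 := le_of_mul_le_mul_right h8 hwpos
  linarith

/-- Stability of test functions: if `φ` touches `f` from above at `y₀`, then a function `w` which is
almost below `f`, and almost equal to it at `y₀`, is touched from above at a nearby point with a
nearby gradient. Only a one-sided bound on `w` is needed, which is what a supremum of functions
provides. -/
theorem exists_test_of_le_add {f φ : E → ℝ} {y₀ : E} {T : Set E} (hT : T ∈ 𝓝 y₀)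
    (hf : ContinuousAt f y₀)
    (hφ : ContDiffAt ℝ 1 φ y₀) (hmax : IsLocalMax (fun y => f y - φ y) y₀)
    {U : Set (E × (E →L[ℝ] ℝ))} (hU : U ∈ 𝓝 (y₀, fderiv ℝ φ y₀)) {δ : ℝ} (hδ : 0 < δ) :
    ∃ η > 0, ∀ w : E → ℝ, ContinuousOn w T → (∀ y ∈ T, w y ≤ f y + η) → f y₀ - η ≤ w y₀ →
      ∃ y ∈ T, ∃ ψ : E → ℝ, ContDiffAt ℝ 1 ψ y ∧ IsLocalMax (fun z => w z - ψ z) y ∧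
        (y, fderiv ℝ ψ y) ∈ U ∧ |w y - f y₀| < δ := by
  -- the quadratic term makes the maximum of `f - ψ` at `y₀` strict
  set ψ : E → ℝ := fun y => φ y + 1 * ‖y - y₀‖ ^ 2 with hψ
  have hψC : ContDiffAt ℝ 1 ψ y₀ := hφ.add (contDiff_const_mul_norm_sub_sq 1 y₀).contDiffAt
  have hψd : fderiv ℝ ψ y₀ = fderiv ℝ φ y₀ := by
    have := ((hφ.differentiableAt one_ne_zero).hasFDerivAt.add
      (hasFDerivAt_const_mul_norm_sub_sq 1 y₀ y₀)).fderiv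
    rw [sub_self, map_zero, smul_zero, add_zero] at this
    exact this
  have hψcont : ContinuousAt (fun y => (y, fderiv ℝ ψ y)) y₀ :=
    continuousAt_id.prodMk (hψC.continuousAt_fderiv one_ne_zero)
  have e1 : ∀ᶠ y in 𝓝 y₀, (y, fderiv ℝ ψ y) ∈ U := hψcont.eventually
    (show ∀ᶠ z in 𝓝 (y₀, fderiv ℝ ψ y₀), z ∈ U by rw [hψd]; exact hU)
  have e2 : ∀ᶠ y in 𝓝 y₀, ContDiffAt ℝ 1 ψ y := hψC.eventually (by simp)
  have e3 : ∀ᶠ y in 𝓝 y₀, |f y - f y₀| < δ / 4 := by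
    simpa [Real.dist_eq] using Metric.continuousAt_iff'.1 hf (δ / 4) (by positivity)
  have e4 : ∀ᶠ y in 𝓝 y₀, |φ y - φ y₀| < δ / 4 := by
    simpa [Real.dist_eq] using Metric.continuousAt_iff'.1 hφ.continuousAt (δ / 4) (by positivity)
  obtain ⟨r, hr, hball⟩ := Metric.nhds_basis_closedBall.eventually_iff.1
    (((((e1.and e2).and e3).and e4).and hT).and hmax)
  refine ⟨min (r ^ 2 / 4) (δ / 4), by positivity, fun w hw hwle hwge => ?_⟩
  set η := min (r ^ 2 / 4) (δ / 4) with hη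
  have hη1 : η ≤ r ^ 2 / 4 := min_le_left _ _
  have hη2 : η ≤ δ / 4 := min_le_right _ _
  have hsubT : closedBall y₀ r ⊆ T := fun y hy => (hball hy).1.2
  have hcontψ : ContinuousOn ψ (closedBall y₀ r) := fun y hy =>
    (hball hy).1.1.1.1.2.continuousAt.continuousWithinAt
  obtain ⟨y, hy, hymax⟩ := (isCompact_closedBall y₀ r).exists_isMaxOn
    ⟨y₀, mem_closedBall_self hr.le⟩ ((hw.mono hsubT).sub hcontψ)
  have hymax' : ∀ z ∈ closedBall y₀ r, w z - ψ z ≤ w y - ψ y := fun z hz => hymax hz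
  have h0 := hymax' y₀ (mem_closedBall_self hr.le)
  simp only [hψ, sub_self, norm_zero] at h0
  obtain ⟨⟨⟨⟨⟨h1, h2⟩, h3⟩, h4⟩, h5⟩, h6⟩ := hball hy
  have h7 := hwle y h5
  have hyr : ‖y - y₀‖ < r := by
    refine lt_of_pow_lt_pow_left₀ 2 hr.le ?_
    nlinarith
  refine ⟨y, h5, ψ, h2, ?_, h1, ?_⟩
  · filter_upwards [isOpen_ball.mem_nhds (show y ∈ ball y₀ r by rwa [mem_ball, dist_eq_norm])]
      with z hz
    exact hymax' z (ball_subset_closedBall hz)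
  · have h8 := abs_lt.1 h3
    have h9 := abs_lt.1 h4
    have h10 := sq_nonneg ‖y - y₀‖
    rw [abs_lt]
    constructor <;> linarith

end Euclidean

/-! ### Scalar Hamilton-Jacobi inequalities -/

section Scalar

variable {n : ℕ} {M : Type*} [TopologicalSpace M] [ChartedSpace (EuclideanSpace ℝ (Fin n)) M]

/-- The set of points `(x, p)` of `T*M` with `p ∈ D⁺u(x)`. -/
def superjet (n : ℕ) {M : Type*} [TopologicalSpace M]
    [ChartedSpace (EuclideanSpace ℝ (Fin n)) M] (u : M → ℝ) : Set (CotangentBundle n M) :=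
  {z | z.2 ∈ superdifferential n u z.1}

/-- The set of points `(x, p)` of `T*M` with `p ∈ D⁻u(x)`. -/
def subjet (n : ℕ) {M : Type*} [TopologicalSpace M]
    [ChartedSpace (EuclideanSpace ℝ (Fin n)) M] (u : M → ℝ) : Set (CotangentBundle n M) :=
  {z | z.2 ∈ subdifferential n u z.1}

theorem continuousOn_comp_extChartAt_symm {u : M → ℝ} (hu : Continuous u) (x₀ : M) :
    ContinuousOn (fun y => u ((extChartAt (𝓡 n) x₀).symm y)) (extChartAt (𝓡 n) x₀).target :=
  hu.comp_continuousOn (continuousOn_extChartAt_symm x₀)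

variable [IsManifold (𝓡 n) ∞ M]

theorem ofCoord_mem_superjet {u : M → ℝ} {x₀ : M} {y : EuclideanSpace ℝ (Fin n)}
    (hy : y ∈ (extChartAt (𝓡 n) x₀).target) {φ : EuclideanSpace ℝ (Fin n) → ℝ}
    (hφ : ContDiffAt ℝ 1 φ y)
    (hmax : IsLocalMax (fun z => u ((extChartAt (𝓡 n) x₀).symm z) - φ z) y) :
    ofCoord x₀ y (fderiv ℝ φ y) ∈ superjet n u :=
  mem_superdifferential_of_coord hy hφ hmax

theorem ofCoord_mem_subjet {u : M → ℝ} {x₀ : M} {y : EuclideanSpace ℝ (Fin n)}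
    (hy : y ∈ (extChartAt (𝓡 n) x₀).target) {φ : EuclideanSpace ℝ (Fin n) → ℝ}
    (hφ : ContDiffAt ℝ 1 φ y)
    (hmin : IsLocalMin (fun z => u ((extChartAt (𝓡 n) x₀).symm z) - φ z) y) :
    ofCoord x₀ y (fderiv ℝ φ y) ∈ subjet n u :=
  mem_subdifferential_of_coord hy hφ hmin

theorem exists_coord_of_mem_subdifferential {u : M → ℝ} {x₀ : M}
    {p : TangentSpace (𝓡 n) x₀ →L[ℝ] ℝ} (hp : p ∈ subdifferential n u x₀) :
    ∃ φ : EuclideanSpace ℝ (Fin n) → ℝ, ContDiffAt ℝ 1 φ (extChartAt (𝓡 n) x₀ x₀) ∧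
      IsLocalMin (fun z => u ((extChartAt (𝓡 n) x₀).symm z) - φ z) (extChartAt (𝓡 n) x₀ x₀) ∧
      ofCoord x₀ (extChartAt (𝓡 n) x₀ x₀) (fderiv ℝ φ (extChartAt (𝓡 n) x₀ x₀)) = ⟨x₀, p⟩ := by
  obtain ⟨φ, hφ, hmax, h⟩ :=
    exists_coord_of_mem_superdifferential (mem_subdifferential_iff_neg.1 hp)
  refine ⟨fun y => -φ y, hφ.neg, by filter_upwards [hmax] with z hz; linarith, ?_⟩
  have h2 := congrArg (fun z : CotangentBundle n M => (⟨z.1, -z.2⟩ : CotangentBundle n M)) h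
  simp only [neg_neg] at h2
  rw [← h2, show fderiv ℝ (fun y => -φ y) (extChartAt (𝓡 n) x₀ x₀) =
    -fderiv ℝ φ (extChartAt (𝓡 n) x₀ x₀) from fderiv_neg, ofCoord, coordCovector_neg]
  rfl

/-- Coercivity in the fibres, locally uniform in the base point. It is expressed with the Euclidean
norm of the coordinates in charts, so that the Riemannian metric enters only in
`locallyCoercive_of_tendsto`. -/
def LocallyCoercive (G : CotangentBundle n M → ℝ) : Prop :=
  ∀ (x₀ : M) (C : ℝ), ∃ R : ℝ, 0 ≤ R ∧ ∀ᶠ y in 𝓝 (extChartAt (𝓡 n) x₀ x₀),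
    ∀ q : EuclideanSpace ℝ (Fin n) →L[ℝ] ℝ, G (ofCoord x₀ y q) ≤ C → ‖q‖ ≤ R

theorem locallyCoercive_of_tendsto [RiemannianBundle (fun x : M => TangentSpace (𝓡 n) x)]
    [IsContMDiffRiemannianBundle (𝓡 n) ∞ (EuclideanSpace ℝ (Fin n))
      (fun x : M => TangentSpace (𝓡 n) x)] {G : CotangentBundle n M → ℝ} {α : ℝ → ℝ}
    (hα : Tendsto α atTop atTop)
    (h : ∀ (x : M) (p : TangentSpace (𝓡 n) x →L[ℝ] ℝ), α ‖p‖ ≤ G ⟨x, p⟩) :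
    LocallyCoercive G := by
  intro x₀ C
  obtain ⟨K, hK, hev⟩ := eventually_norm_le_norm_coordCovector (n := n) x₀
  obtain ⟨R, hR⟩ := eventually_atTop.1 (hα.eventually_gt_atTop C)
  refine ⟨max R 0 * K, by positivity, ?_⟩
  filter_upwards [hev] with y hy q hq
  refine (hy q).trans (mul_le_mul_of_nonneg_right ?_ hK.le)
  by_contra! hlt
  have := hR _ ((le_max_left _ _).trans hlt.le)
  exact absurd ((h _ _).trans hq) (not_le.2 this)

/-- Elements of the superdifferential of `u` and of the subdifferential of `v` have a common limit
point `q₀` at a local maximum of `u - v`, provided that those of `u` satisfy a coercive inequality.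
Being the same for all neighbourhoods, `q₀` allows one to pass to the limit in inequalities that
involve a Hamiltonian which is merely continuous. -/
theorem exists_common_limit_covector {G : CotangentBundle n M → ℝ} (hG : LocallyCoercive G)
    {u v : M → ℝ} {x₀ : M} (hu : Continuous u) (hv : ∀ᶠ x in 𝓝 x₀, ContinuousAt v x)
    (hmax : IsLocalMax (fun x => u x - v x) x₀) {f : M → ℝ} (hf : Continuous f)
    (hsub : ∀ z ∈ superjet n u, G z ≤ f z.1) :
    ∃ q₀, ∀ W ∈ 𝓝 (extChartAt (𝓡 n) x₀ x₀, q₀), ∃ a ∈ (extChartAt (𝓡 n) x₀).target,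
      ∃ b ∈ (extChartAt (𝓡 n) x₀).target, ∃ φ χ : EuclideanSpace ℝ (Fin n) → ℝ,
      ContDiff ℝ 1 φ ∧ ContDiff ℝ 1 χ ∧
      IsLocalMax (fun y => u ((extChartAt (𝓡 n) x₀).symm y) - φ y) a ∧
      IsLocalMin (fun y => v ((extChartAt (𝓡 n) x₀).symm y) - χ y) b ∧
      (a, fderiv ℝ φ a) ∈ W ∧ (b, fderiv ℝ χ b) ∈ W := by
  set e := extChartAt (𝓡 n) x₀ with he
  have hlim := tendsto_extChartAt_symm (n := n) x₀
  have htgt : ∀ᶠ y in 𝓝 (e x₀), y ∈ e.target := extChartAt_target_mem_nhds x₀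
  obtain ⟨R, hR, hRev⟩ := hG x₀ (f x₀ + 1)
  have hfev : ∀ᶠ y in 𝓝 (e x₀), f (e.symm y) < f x₀ + 1 :=
    hlim.eventually (hf.continuousAt.eventually_lt_const (lt_add_one _))
  have hmax' : ∀ᶠ y in 𝓝 (e x₀), u (e.symm y) - v (e.symm y) ≤
      u (e.symm (e x₀)) - v (e.symm (e x₀)) := by
    filter_upwards [hlim.eventually hmax] with y hy
    rwa [he, extChartAt_to_inv, ← he]
  obtain ⟨r, hr, hball⟩ := Metric.nhds_basis_closedBall.eventually_iff.1
    (((htgt.and (hlim.eventually hv)).and hmax').and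
      (hfev.and hRev))
  have hut : ContinuousOn (fun y => u (e.symm y)) (Metric.closedBall (e x₀) r) :=
    (continuousOn_comp_extChartAt_symm hu x₀).mono fun y hy => (hball hy).1.1.1
  have hvt : ContinuousOn (fun y => v (e.symm y)) (Metric.closedBall (e x₀) r) := fun y hy =>
    (ContinuousAt.comp (f := e.symm) (hball hy).1.1.2
      (continuousAt_extChartAt_symm'' (hball hy).1.1.1)).continuousWithinAt
  have hpair := fun k : ℕ => exists_test_pair hr hut hvt (fun y hy => (hball hy).1.2)
    (ε := min r (1 / ((k : ℝ) + 1))) (by positivity)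
  choose a ha b hb φ χ hφ hχ hφmax hχmin hclose using hpair
  have hsmall : Tendsto (fun k : ℕ => 1 / ((k : ℝ) + 1)) atTop (𝓝 0) :=
    tendsto_one_div_add_atTop_nhds_zero_nat
  have hamem : ∀ k, a k ∈ Metric.closedBall (e x₀) r := fun k =>
    Metric.ball_subset_closedBall (Metric.ball_subset_ball (min_le_left _ _) (ha k))
  have hbmem : ∀ k, b k ∈ Metric.closedBall (e x₀) r := fun k =>
    Metric.ball_subset_closedBall (Metric.ball_subset_ball (min_le_left _ _) (hb k))
  have halim : Tendsto a atTop (𝓝 (e x₀)) := by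
    rw [tendsto_iff_dist_tendsto_zero]
    exact squeeze_zero (fun _ => dist_nonneg)
      (fun k => ((Metric.mem_ball.1 (ha k)).trans_le (min_le_right _ _)).le) hsmall
  have hblim : Tendsto b atTop (𝓝 (e x₀)) := by
    rw [tendsto_iff_dist_tendsto_zero]
    exact squeeze_zero (fun _ => dist_nonneg)
      (fun k => ((Metric.mem_ball.1 (hb k)).trans_le (min_le_right _ _)).le) hsmall
  have hbound : ∀ k, fderiv ℝ (φ k) (a k) ∈ Metric.closedBall
      (0 : EuclideanSpace ℝ (Fin n) →L[ℝ] ℝ) R := fun k => by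
    rw [mem_closedBall_zero_iff]
    obtain ⟨⟨⟨h1, -⟩, -⟩, h2, h3⟩ := hball (hamem k)
    exact h3 _ ((hsub _ (ofCoord_mem_superjet h1 (hφ k).contDiffAt (hφmax k))).trans h2.le)
  obtain ⟨q₀, -, θ, hθ, hq⟩ := (isCompact_closedBall _ _).tendsto_subseq hbound
  refine ⟨q₀, fun W hW => ?_⟩
  have hq' : Tendsto (fun k => fderiv ℝ (χ (θ k)) (b (θ k))) atTop (𝓝 q₀) := by
    have hd : Tendsto (fun k => fderiv ℝ (φ (θ k)) (a (θ k)) - fderiv ℝ (χ (θ k)) (b (θ k)))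
        atTop (𝓝 0) := by
      refine squeeze_zero_norm (fun k => ((hclose (θ k)).trans_le (min_le_right _ _)).le)
        (hsmall.comp hθ.tendsto_atTop)
    simpa using hq.sub hd
  have l1 : Tendsto (fun k => (a (θ k), fderiv ℝ (φ (θ k)) (a (θ k)))) atTop (𝓝 (e x₀, q₀)) :=
    (halim.comp hθ.tendsto_atTop).prodMk_nhds hq
  have l2 : Tendsto (fun k => (b (θ k), fderiv ℝ (χ (θ k)) (b (θ k)))) atTop (𝓝 (e x₀, q₀)) :=
    (hblim.comp hθ.tendsto_atTop).prodMk_nhds hq'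
  obtain ⟨k, hk1, hk2⟩ := ((l1.eventually hW).and (l2.eventually hW)).exists
  exact ⟨a (θ k), (hball (hamem _)).1.1.1, b (θ k), (hball (hbmem _)).1.1.1, φ (θ k), χ (θ k),
    hφ _, hχ _, hφmax _, hχmin _, hk1, hk2⟩

theorem continuousAt_comp_ofCoord {G : CotangentBundle n M → ℝ} (hG : Continuous G) (x₀ : M)
    (q : EuclideanSpace ℝ (Fin n) →L[ℝ] ℝ) :
    ContinuousAt (fun z : EuclideanSpace ℝ (Fin n) × (EuclideanSpace ℝ (Fin n) →L[ℝ] ℝ) =>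
      G (ofCoord x₀ z.1 z.2)) (extChartAt (𝓡 n) x₀ x₀, q) :=
  hG.continuousAt.comp (f := fun z : EuclideanSpace ℝ (Fin n) ×
    (EuclideanSpace ℝ (Fin n) →L[ℝ] ℝ) => ofCoord x₀ z.1 z.2)
    (continuousAt_ofCoord (mem_extChartAt_target x₀) q)

omit [IsManifold (𝓡 n) ∞ M] in
theorem continuousAt_comp_extChartAt_symm {f : M → ℝ} (hf : Continuous f) (x₀ : M)
    (q : EuclideanSpace ℝ (Fin n) →L[ℝ] ℝ) :
    ContinuousAt (fun z : EuclideanSpace ℝ (Fin n) × (EuclideanSpace ℝ (Fin n) →L[ℝ] ℝ) =>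
      f ((extChartAt (𝓡 n) x₀).symm z.1)) (extChartAt (𝓡 n) x₀ x₀, q) :=
  hf.continuousAt.comp (f := fun z : EuclideanSpace ℝ (Fin n) ×
    (EuclideanSpace ℝ (Fin n) →L[ℝ] ℝ) => (extChartAt (𝓡 n) x₀).symm z.1)
    (ContinuousAt.comp (f := Prod.fst) (x := (extChartAt (𝓡 n) x₀ x₀, q))
      (continuousAt_extChartAt_symm x₀) continuousAt_fst)

/-- Scalar comparison at a local maximum of the difference of a subsolution of `G = f` and a
supersolution of `G = g`. -/
theorem le_of_isLocalMax_sub {G : CotangentBundle n M → ℝ} (hGc : Continuous G)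
    (hG : LocallyCoercive G) {u v f g : M → ℝ} {x₀ : M} (hu : Continuous u) (hv : Continuous v)
    (hmax : IsLocalMax (fun x => u x - v x) x₀) (hf : Continuous f) (hg : Continuous g)
    (hsub : ∀ z ∈ superjet n u, G z ≤ f z.1) (hsup : ∀ z ∈ subjet n v, g z.1 ≤ G z) :
    g x₀ ≤ f x₀ := by
  obtain ⟨q₀, hq₀⟩ := exists_common_limit_covector hG hu
    (Eventually.of_forall fun x => hv.continuousAt) hmax hf hsub
  refine le_of_forall_pos_le_add fun ε hε => ?_
  have hG' := continuousAt_comp_ofCoord hGc x₀ q₀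
  have hf' := continuousAt_comp_extChartAt_symm (n := n) hf x₀ q₀
  have hg' := continuousAt_comp_extChartAt_symm (n := n) hg x₀ q₀
  have e1 := Metric.continuousAt_iff'.1 hG' (ε / 4) (by positivity)
  have e2 := Metric.continuousAt_iff'.1 hf' (ε / 4) (by positivity)
  have e3 := Metric.continuousAt_iff'.1 hg' (ε / 4) (by positivity)
  obtain ⟨a, ha, b, hb, φ, χ, hφ, hχ, hφm, hχm, h1, h2⟩ := hq₀ _ ((e1.and e2).and e3)
  have h3 := hsub _ (ofCoord_mem_superjet ha hφ.contDiffAt hφm)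
  have h4 := hsup _ (ofCoord_mem_subjet hb hχ.contDiffAt hχm)
  simp only [Set.mem_ofPred_eq, Real.dist_eq, extChartAt_to_inv] at h1 h2
  obtain ⟨⟨h5, h6⟩, -⟩ := h1
  obtain ⟨⟨h7, -⟩, h8⟩ := h2
  rw [abs_lt] at h5 h6 h7 h8
  change G _ ≤ f ((extChartAt (𝓡 n) x₀).symm a) at h3
  change g ((extChartAt (𝓡 n) x₀).symm b) ≤ G _ at h4
  linarith [h5.1, h5.2, h6.1, h6.2, h7.1, h7.2, h8.1, h8.2]

/-- A continuous function has a nonempty superdifferential at a dense set of points. -/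
theorem exists_mem_superjet_fst_mem {u : M → ℝ} (hu : Continuous u) (x₀ : M) {V : Set M}
    (hV : V ∈ 𝓝 x₀) : ∃ z ∈ superjet n u, z.1 ∈ V := by
  set e := extChartAt (𝓡 n) x₀ with he
  have htgt : ∀ᶠ y in 𝓝 (e x₀), y ∈ e.target := extChartAt_target_mem_nhds x₀
  have hV' : e.symm ⁻¹' V ∈ 𝓝 (e x₀) := tendsto_extChartAt_symm (n := n) x₀ hV
  obtain ⟨r, hr, hball⟩ := Metric.nhds_basis_closedBall.mem_iff.1 (inter_mem htgt hV')
  have hut : ContinuousOn (fun y => u (e.symm y)) (Metric.closedBall (e x₀) r) :=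
    (continuousOn_comp_extChartAt_symm hu x₀).mono fun y hy => (hball hy).1
  obtain ⟨a, ha, b, hb, φ, χ, hφ, hχ, hφm, hχm, h⟩ :=
    exists_test_pair hr hut hut (fun y hy => by simp) hr
  have := hball (Metric.ball_subset_closedBall ha)
  exact ⟨_, ofCoord_mem_superjet this.1 hφ.contDiffAt hφm, this.2⟩

/-- Subsolutions of a coercive inequality are equicontinuous. -/
theorem exists_nhds_abs_sub_le {G : CotangentBundle n M → ℝ} (hG : LocallyCoercive G) (C : ℝ)
    (x₀ : M) {ε : ℝ} (hε : 0 < ε) : ∃ V ∈ 𝓝 x₀, ∀ u : M → ℝ, Continuous u →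
      (∀ z ∈ superjet n u, G z ≤ C) → ∀ x ∈ V, |u x - u x₀| ≤ ε := by
  set e := extChartAt (𝓡 n) x₀ with he
  have htgt : ∀ᶠ y in 𝓝 (e x₀), y ∈ e.target := extChartAt_target_mem_nhds x₀
  obtain ⟨R, hR, hRev⟩ := hG x₀ C
  obtain ⟨r, hr, hball⟩ := Metric.nhds_basis_closedBall.eventually_iff.1
    (htgt.and hRev)
  set ρ := r / 2 with hρ
  have hρ0 : 0 < ρ := by positivity
  have key : ∀ u : M → ℝ, Continuous u → (∀ z ∈ superjet n u, G z ≤ C) →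
      ∀ y ∈ Metric.closedBall (e x₀) ρ, ∀ z ∈ Metric.closedBall y (ρ / 2),
      u (e.symm z) - u (e.symm y) ≤ 2 * (R + 1) * ‖z - y‖ := by
    intro u hu hsub y hy z hz
    have hsubset : Metric.closedBall y ρ ⊆ Metric.closedBall (e x₀) r := by
      refine Metric.closedBall_subset_closedBall' ?_
      rw [Metric.mem_closedBall] at hy
      linarith
    refine sub_le_of_forall_test_norm_le hρ0 hR (f := fun y => u (e.symm y))
      ((continuousOn_comp_extChartAt_symm hu x₀).mono fun y hy => (hball (hsubset hy)).1)
      (fun w hw φ hφ hmax => ?_) hz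
    have h1 := hball (hsubset (Metric.ball_subset_closedBall hw))
    exact h1.2 _ (hsub _ (ofCoord_mem_superjet h1.1 hφ hmax))
  set s := min (ρ / 2) (ε / (2 * (R + 1))) with hs
  have hs0 : 0 < s := by positivity
  refine ⟨e.source ∩ e ⁻¹' Metric.ball (e x₀) s, inter_mem (extChartAt_source_mem_nhds x₀)
    ((continuousAt_extChartAt (I := 𝓡 n) x₀) (Metric.ball_mem_nhds _ hs0)), ?_⟩
  rintro u hu hsub x ⟨hx, hxs⟩
  have hxs' : ‖e x - e x₀‖ < s := by rwa [← dist_eq_norm]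
  have h1 : s ≤ ρ / 2 := min_le_left _ _
  have h2 : 2 * (R + 1) * ‖e x - e x₀‖ ≤ ε := by
    have h3 : s ≤ ε / (2 * (R + 1)) := min_le_right _ _
    rw [le_div_iff₀ (by positivity)] at h3
    have := mul_le_mul_of_nonneg_left hxs'.le (show 0 ≤ 2 * (R + 1) by positivity)
    linarith
  have h4 := key u hu hsub (e x₀) (Metric.mem_closedBall_self hρ0.le) (e x)
    (by rw [Metric.mem_closedBall, dist_eq_norm]; linarith)
  have h5 := key u hu hsub (e x) (by rw [Metric.mem_closedBall, dist_eq_norm]; linarith) (e x₀)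
    (by rw [Metric.mem_closedBall, dist_eq_norm, norm_sub_rev]; linarith)
  rw [norm_sub_rev] at h5
  rw [e.left_inv hx, he, extChartAt_to_inv, ← he] at h4 h5
  rw [abs_le]
  constructor <;> linarith

/-- Subsolutions of a coercive inequality on a compact connected manifold have uniformly bounded
oscillation. -/
theorem exists_forall_abs_sub_le [CompactSpace M] [ConnectedSpace M]
    {G : CotangentBundle n M → ℝ} (hG : LocallyCoercive G) (C : ℝ) :
    ∃ K : ℝ, ∀ u : M → ℝ, Continuous u → (∀ z ∈ superjet n u, G z ≤ C) →
      ∀ x y, |u x - u y| ≤ K := by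
  obtain ⟨x₁⟩ : Nonempty M := inferInstance
  set P : (M → ℝ) → Prop := fun u => Continuous u ∧ ∀ z ∈ superjet n u, G z ≤ C with hP
  have hV := fun x₀ : M => exists_nhds_abs_sub_le hG C x₀ one_pos
  choose V hVn hV using hV
  -- the points that are controlled from `x₁` form a clopen set
  set A : Set M := {x | ∃ K, ∀ u, P u → |u x - u x₁| ≤ K} with hA
  have hAopen : IsOpen A := by
    rw [isOpen_iff_mem_nhds]
    rintro x ⟨K, hK⟩
    filter_upwards [hVn x] with y hy
    refine ⟨1 + K, fun u hu => (abs_sub_le _ (u x) _).trans ?_⟩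
    exact add_le_add (hV x u hu.1 hu.2 y hy) (hK u hu)
  have hAclosed : IsClosed A := by
    rw [← isOpen_compl_iff, isOpen_iff_mem_nhds]
    intro x hx
    filter_upwards [hVn x] with y hy hyA
    obtain ⟨K, hK⟩ := hyA
    refine hx ⟨1 + K, fun u hu => (abs_sub_le _ (u y) _).trans ?_⟩
    rw [abs_sub_comm]
    exact add_le_add (hV x u hu.1 hu.2 y hy) (hK u hu)
  have hAuniv : A = univ := IsClopen.eq_univ ⟨hAclosed, hAopen⟩ ⟨x₁, 0, fun u _ => by simp⟩
  obtain ⟨t, -, ht⟩ := isCompact_univ.elim_nhds_subcover V fun x _ => hVn x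
  have hAll : ∀ x, ∃ K, ∀ u, P u → |u x - u x₁| ≤ K := fun x => hAuniv.ge (mem_univ x)
  choose K hK using hAll
  have hKx : ∀ x, ∀ u, P u → |u x - u x₁| ≤ 1 + ∑ y ∈ t, |K y| := by
    intro x u hu
    obtain ⟨y, hyt, hxy⟩ := mem_iUnion₂.1 (ht (mem_univ x))
    refine (abs_sub_le _ (u y) _).trans (add_le_add (hV y u hu.1 hu.2 x hxy) ?_)
    exact (hK y u hu).trans ((le_abs_self _).trans
      (Finset.single_le_sum (f := fun y => |K y|) (fun _ _ => abs_nonneg _) hyt))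
  refine ⟨2 * (1 + ∑ y ∈ t, |K y|), fun u hu hsub x y => ?_⟩
  have h1 := abs_le.1 (hKx x u ⟨hu, hsub⟩)
  have h2 := abs_le.1 (hKx y u ⟨hu, hsub⟩)
  rw [abs_le]
  constructor <;> linarith [h1.1, h1.2, h2.1, h2.2]

/-- Stability of the superdifferential under one-sided perturbations of the function. -/
theorem exists_mem_superjet_of_le_add {u : M → ℝ} (hu : Continuous u) {z₀ : CotangentBundle n M}
    (hz₀ : z₀ ∈ superjet n u) {N : Set (CotangentBundle n M)} (hN : N ∈ 𝓝 z₀) {δ : ℝ}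
    (hδ : 0 < δ) : ∃ η > 0, ∀ w : M → ℝ, Continuous w → (∀ x, w x ≤ u x + η) →
      u z₀.1 - η ≤ w z₀.1 → ∃ z ∈ superjet n w, z ∈ N ∧ |w z.1 - u z₀.1| < δ := by
  obtain ⟨x₀, p⟩ := z₀
  obtain ⟨φ, hφ, hmax, heq⟩ := exists_coord_of_mem_superdifferential hz₀
  have hU := (continuousAt_ofCoord (mem_extChartAt_target x₀)
    (fderiv ℝ φ (extChartAt (𝓡 n) x₀ x₀))).preimage_mem_nhds (t := N) (by rwa [heq])
  obtain ⟨η, hη, h⟩ := exists_test_of_le_add (extChartAt_target_mem_nhds (I := 𝓡 n) x₀)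
    ((continuousOn_comp_extChartAt_symm hu x₀).continuousAt (extChartAt_target_mem_nhds x₀))
    hφ hmax hU hδ
  refine ⟨η, hη, fun w hw hle hge => ?_⟩
  obtain ⟨y, hy, ψ, hψ, hψm, hmem, hlt⟩ := h (fun y => w ((extChartAt (𝓡 n) x₀).symm y))
    (continuousOn_comp_extChartAt_symm hw x₀) (fun y _ => hle _) (by simpa using hge)
  simp only [extChartAt_to_inv] at hlt
  exact ⟨_, ofCoord_mem_superjet hy hψ hψm, hmem, hlt⟩

/-- Stability of the subdifferential under uniform convergence. -/
theorem exists_mem_subjet_of_abs_sub_le {u : M → ℝ} (hu : Continuous u)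
    {z₀ : CotangentBundle n M} (hz₀ : z₀ ∈ subjet n u) {N : Set (CotangentBundle n M)}
    (hN : N ∈ 𝓝 z₀) : ∃ η > 0, ∀ w : M → ℝ, Continuous w → (∀ x, |w x - u x| ≤ η) →
      ∃ z ∈ subjet n w, z ∈ N := by
  obtain ⟨x₀, p⟩ := z₀
  obtain ⟨φ, hφ, hmin, heq⟩ := exists_coord_of_mem_subdifferential hz₀
  have hU := (continuousAt_ofCoord (mem_extChartAt_target x₀)
    (fderiv ℝ φ (extChartAt (𝓡 n) x₀ x₀))).preimage_mem_nhds (t := N) (by rwa [heq])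
  have hneg : fderiv ℝ (fun y => -φ y) (extChartAt (𝓡 n) x₀ x₀) =
    -fderiv ℝ φ (extChartAt (𝓡 n) x₀ x₀) := fderiv_neg
  have hU' : (fun z : EuclideanSpace ℝ (Fin n) × (EuclideanSpace ℝ (Fin n) →L[ℝ] ℝ) =>
      (z.1, -z.2)) ⁻¹' ((fun z => ofCoord (M := M) x₀ z.1 z.2) ⁻¹' N) ∈
      𝓝 (extChartAt (𝓡 n) x₀ x₀, fderiv ℝ (fun y => -φ y) (extChartAt (𝓡 n) x₀ x₀)) := by
    refine ContinuousAt.preimage_mem_nhds (by fun_prop) ?_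
    simpa only [hneg, neg_neg] using hU
  obtain ⟨η, hη, h⟩ := exists_test_of_le_add (f := fun y => -u ((extChartAt (𝓡 n) x₀).symm y))
    (extChartAt_target_mem_nhds (I := 𝓡 n) x₀)
    ((continuousOn_comp_extChartAt_symm hu.neg x₀).continuousAt (extChartAt_target_mem_nhds x₀))
    hφ.neg (by filter_upwards [hmin] with z hz; linarith) hU' one_pos
  refine ⟨η, hη, fun w hw hle => ?_⟩
  obtain ⟨y, hy, ψ, hψ, hψm, hmem, -⟩ := h (fun y => -w ((extChartAt (𝓡 n) x₀).symm y))
    (continuousOn_comp_extChartAt_symm hw.neg x₀)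
    (fun y _ => by have := abs_le.1 (hle ((extChartAt (𝓡 n) x₀).symm y)); linarith [this.1])
    (by have := abs_le.1 (hle ((extChartAt (𝓡 n) x₀).symm (extChartAt (𝓡 n) x₀ x₀)))
        linarith [this.2])
  refine ⟨ofCoord x₀ y (fderiv ℝ (fun z => -ψ z) y), ofCoord_mem_subjet hy hψ.neg
    (by filter_upwards [hψm] with z hz; linarith), ?_⟩
  rw [show fderiv ℝ (fun z => -ψ z) y = -fderiv ℝ ψ y from fderiv_neg]
  exact hmem

end Scalar

/-! ### Tests from below, and convexity -/

section Touching

variable {n : ℕ} {M : Type*} [TopologicalSpace M] [ChartedSpace (EuclideanSpace ℝ (Fin n)) M]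

theorem superdifferential_subset_of_le {u w : M → ℝ} {x : M} (hle : ∀ᶠ y in 𝓝 x, u y ≤ w y)
    (heq : u x = w x) : superdifferential n w x ⊆ superdifferential n u x := by
  rintro p ⟨φ, hφ, hmax, hp⟩
  refine ⟨φ, hφ, ?_, hp⟩
  filter_upwards [hmax, hle] with y h1 h2
  linarith

theorem mfderiv_eq_zero_of_isLocalMax {f : M → ℝ} {x : M} (hmax : IsLocalMax f x) :
    mfderiv (𝓡 n) 𝓘(ℝ, ℝ) f x = 0 := by
  by_cases hf : MDifferentiableAt (𝓡 n) 𝓘(ℝ, ℝ) f x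
  · have hloc : IsLocalMax (writtenInExtChartAt (𝓡 n) 𝓘(ℝ, ℝ) x f) (extChartAt (𝓡 n) x x) := by
      filter_upwards [(tendsto_extChartAt_symm (n := n) x).eventually hmax] with y hy
      simpa only [writtenInExtChartAt, extChartAt_model_space_eq_id, PartialEquiv.refl_coe,
        Function.comp_apply, id, extChartAt_to_inv] using hy
    rw [hf.mfderiv, ModelWithCorners.range_eq_univ, fderivWithin_univ]
    exact hloc.fderiv_eq_zero
  · exact mfderiv_zero_of_not_mdifferentiableAt hf

variable [IsManifold (𝓡 n) ∞ M]

/-- At a point where `w` is touched from below by a differentiable function `ψ`, the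
superdifferential of `w` contains at most the differential of `ψ`. -/
theorem eq_ofCoord_of_mem_superjet {w : M → ℝ} {z : CotangentBundle n M} (hz : z ∈ superjet n w)
    {x₀ : M} (hx : z.1 ∈ (extChartAt (𝓡 n) x₀).source) {ψ : EuclideanSpace ℝ (Fin n) → ℝ}
    (hψ : DifferentiableAt ℝ ψ (extChartAt (𝓡 n) x₀ z.1))
    (hle : ∀ᶠ y in 𝓝 z.1, ψ (extChartAt (𝓡 n) x₀ y) ≤ w y)
    (heq : ψ (extChartAt (𝓡 n) x₀ z.1) = w z.1) :
    z = ofCoord x₀ (extChartAt (𝓡 n) x₀ z.1) (fderiv ℝ ψ (extChartAt (𝓡 n) x₀ z.1)) := by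
  obtain ⟨x, p⟩ := z
  obtain ⟨φ, hφ, hmax, hp⟩ := hz
  simp only at hx hψ hle heq hp hmax hφ ⊢
  have hy := (extChartAt (𝓡 n) x₀).map_source hx
  have hleft := (extChartAt (𝓡 n) x₀).left_inv hx
  have hψM : MDifferentiableAt (𝓡 n) 𝓘(ℝ, ℝ) (ψ ∘ extChartAt (𝓡 n) x₀) x :=
    MDifferentiableAt.comp (I' := 𝓘(ℝ, EuclideanSpace ℝ (Fin n))) x hψ.mdifferentiableAt
      (mdifferentiableAt_extChartAt (by rwa [extChartAt_source] at hx))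
  have hφM := hφ.mdifferentiableAt one_ne_zero
  have hloc : IsLocalMax (ψ ∘ extChartAt (𝓡 n) x₀ - φ) x := by
    filter_upwards [hmax, hle] with y h1 h2
    simp only [Pi.sub_apply, Function.comp_apply]
    linarith
  obtain ⟨P, hP⟩ : ∃ P : TangentSpace (𝓡 n) x →L[ℝ] ℝ,
      P = mfderiv (𝓡 n) 𝓘(ℝ, ℝ) (ψ ∘ extChartAt (𝓡 n) x₀) x := ⟨_, rfl⟩
  have h0 : P - p = 0 := by
    rw [hP, ← hp]
    exact (mfderiv_sub hψM hφM).symm.trans (mfderiv_eq_zero_of_isLocalMax (n := n) hloc)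
  have key := mfderiv_comp_extChartAt hy hψ
  have h2 : ofCoord x₀ (extChartAt (𝓡 n) x₀ x) (fderiv ℝ ψ (extChartAt (𝓡 n) x₀ x)) =
      (⟨(extChartAt (𝓡 n) x₀).symm (extChartAt (𝓡 n) x₀ x), mfderiv (𝓡 n) 𝓘(ℝ, ℝ)
        (ψ ∘ extChartAt (𝓡 n) x₀)
        ((extChartAt (𝓡 n) x₀).symm (extChartAt (𝓡 n) x₀ x))⟩ : CotangentBundle n M) := by
    rw [key]; rfl
  rw [h2, hleft]
  exact congrArg (fun q => (⟨x, q⟩ : CotangentBundle n M)) (sub_eq_zero.1 h0 ▸ hP :)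

theorem ofCoord_zero (x₀ : M) (y : EuclideanSpace ℝ (Fin n)) :
    ofCoord x₀ y 0 = (⟨(extChartAt (𝓡 n) x₀).symm y, 0⟩ : CotangentBundle n M) := by
  rw [ofCoord, coordCovector, ContinuousLinearMap.zero_comp]

/-- The superdifferential of a constant is `{0}`. -/
theorem eq_zero_of_mem_superjet_const {a : ℝ} {z : CotangentBundle n M}
    (hz : z ∈ superjet n (fun _ : M => a)) : z = ⟨z.1, 0⟩ := by
  have := eq_ofCoord_of_mem_superjet hz (mem_extChartAt_source z.1) (ψ := fun _ => a)
    (differentiableAt_const _) (Eventually.of_forall fun _ => le_rfl) rfl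
  rw [fderiv_fun_const, Pi.zero_apply, ofCoord_zero, extChartAt_to_inv] at this
  exact this

theorem eq_zero_of_mem_subjet_const {a : ℝ} {z : CotangentBundle n M}
    (hz : z ∈ subjet n (fun _ : M => a)) : z = ⟨z.1, 0⟩ := by
  have hz' : (⟨z.1, -z.2⟩ : CotangentBundle n M) ∈ superjet n (fun _ : M => -a) :=
    mem_subdifferential_iff_neg.1 hz
  have h := congrArg (fun z : CotangentBundle n M => (⟨z.1, -z.2⟩ : CotangentBundle n M))
    (eq_zero_of_mem_superjet_const hz')
  simp only [neg_neg, neg_zero] at h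
  exact h

theorem coordCovector_add_smul (x₀ : M) (y : EuclideanSpace ℝ (Fin n)) (s t : ℝ)
    (q q' : EuclideanSpace ℝ (Fin n) →L[ℝ] ℝ) :
    coordCovector x₀ y (s • q + t • q') =
      s • coordCovector x₀ y q + t • coordCovector x₀ y q' := by
  rw [coordCovector, ContinuousLinearMap.add_comp, ContinuousLinearMap.smul_comp,
    ContinuousLinearMap.smul_comp]
  rfl

/-- For a convex coercive Hamiltonian, a convex combination of subsolutions is a subsolution. If `φ`
touches `s u + t v` from above at `x₀`, then `u` is compared with `v' = (φ - t v) / s`: a test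
function of `v'` from below is turned into a test function of `v` from above, and the limit
covectors `q₀` of `u` and `q₁` of `v` satisfy `s q₀ + t q₁ = Dφ(x₀)`. -/
theorem le_of_mem_superjet_convex_comb {G : CotangentBundle n M → ℝ} (hGc : Continuous G)
    (hG : LocallyCoercive G)
    (hconv : ∀ x : M, ConvexOn ℝ univ (fun p : TangentSpace (𝓡 n) x →L[ℝ] ℝ => G ⟨x, p⟩))
    {u v f g : M → ℝ} (hu : Continuous u) (hv : Continuous v) (hf : Continuous f)
    (hg : Continuous g) (hsubu : ∀ z ∈ superjet n u, G z ≤ f z.1)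
    (hsubv : ∀ z ∈ superjet n v, G z ≤ g z.1) {s t : ℝ} (hs : 0 < s) (ht : 0 < t)
    (hst : s + t = 1) : ∀ z ∈ superjet n (fun x => s * u x + t * v x),
      G z ≤ s * f z.1 + t * g z.1 := by
  rintro ⟨x₀, p⟩ hz
  obtain ⟨φ, hφ, hmax, heq⟩ := exists_coord_of_mem_superdifferential hz
  have hlim := tendsto_extChartAt_symm (n := n) x₀
  set e := extChartAt (𝓡 n) x₀ with he
  have hsrc : ∀ᶠ x in 𝓝 x₀, x ∈ e.source := extChartAt_source_mem_nhds x₀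
  have hect : Tendsto e (𝓝 x₀) (𝓝 (e x₀)) := continuousAt_extChartAt (I := 𝓡 n) x₀
  have hφev : ∀ᶠ y in 𝓝 (e x₀), ContDiffAt ℝ 1 φ y := hφ.eventually (by simp)
  set v' : M → ℝ := fun x => (φ (e x) - t * v x) / s with hv'
  have hv'c : ∀ᶠ x in 𝓝 x₀, ContinuousAt v' x := by
    filter_upwards [hsrc, hect.eventually hφev] with x hx hφx
    have h1 : ContinuousAt (fun x => φ (e x)) x :=
      hφx.continuousAt.comp (f := e) (continuousAt_extChartAt' hx)
    exact (h1.sub (continuousAt_const.mul hv.continuousAt)).div_const s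
  have hmax' : IsLocalMax (fun x => u x - v' x) x₀ := by
    filter_upwards [hect.eventually hmax, hsrc] with x hx hxs
    simp only [he, extChartAt_to_inv] at hx
    rw [(extChartAt (𝓡 n) x₀).left_inv hxs, ← he] at hx
    have h1 : u x - v' x = (s * u x + t * v x - φ (e x)) / s := by
      simp only [hv']; field_simp; ring
    have h2 : u x₀ - v' x₀ = (s * u x₀ + t * v x₀ - φ (e x₀)) / s := by
      simp only [hv']; field_simp; ring
    simp only [h1, h2]
    exact div_le_div_of_nonneg_right hx hs.le
  obtain ⟨q₀, hq₀⟩ := exists_common_limit_covector hG hu hv'c hmax' hf hsubu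
  rw [← he] at hq₀
  -- the gradient of a test function for `v` in terms of that of the test function for `v'`
  set Θ : EuclideanSpace ℝ (Fin n) × (EuclideanSpace ℝ (Fin n) →L[ℝ] ℝ) →
      EuclideanSpace ℝ (Fin n) × (EuclideanSpace ℝ (Fin n) →L[ℝ] ℝ) :=
    fun z => (z.1, t⁻¹ • (fderiv ℝ φ z.1 - s • z.2)) with hΘ
  have hΘc : ContinuousAt Θ (e x₀, q₀) := by
    have h1 : ContinuousAt (fun z : EuclideanSpace ℝ (Fin n) ×
        (EuclideanSpace ℝ (Fin n) →L[ℝ] ℝ) => fderiv ℝ φ z.1) (e x₀, q₀) :=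
      ContinuousAt.comp (f := Prod.fst) (x := (e x₀, q₀))
        (hφ.continuousAt_fderiv one_ne_zero) continuousAt_fst
    exact continuousAt_fst.prodMk ((h1.sub (continuousAt_snd.const_smul s)).const_smul t⁻¹)
  set q₁ := t⁻¹ • (fderiv ℝ φ (e x₀) - s • q₀) with hq₁
  have hcomb : fderiv ℝ φ (e x₀) = s • q₀ + t • q₁ := by
    rw [hq₁, smul_inv_smul₀ ht.ne']; abel
  -- both limit covectors satisfy the limiting inequality
  have hfst : G (ofCoord x₀ (e x₀) q₀) ≤ f x₀ := by
    refine le_of_forall_pos_le_add fun ε hε => ?_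
    have e1 := Metric.continuousAt_iff'.1 (continuousAt_comp_ofCoord hGc x₀ q₀) (ε / 2)
      (by positivity)
    have e2 := Metric.continuousAt_iff'.1 (continuousAt_comp_extChartAt_symm (n := n) hf x₀ q₀)
      (ε / 2) (by positivity)
    obtain ⟨a, ha, b, hb, χ, χ', hχ, hχ', hm, hm', h1, h2⟩ := hq₀ _ (e1.and e2)
    have h3 : G _ ≤ f (e.symm a) := hsubu _ (ofCoord_mem_superjet ha hχ.contDiffAt hm)
    simp only [Set.mem_ofPred_eq, Real.dist_eq, extChartAt_to_inv] at h1
    have h4 := abs_lt.1 h1.1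
    have h5 := abs_lt.1 h1.2
    linarith [h4.1, h5.2]
  have hsnd : G (ofCoord x₀ (e x₀) q₁) ≤ g x₀ := by
    refine le_of_forall_pos_le_add fun ε hε => ?_
    have e1 := Metric.continuousAt_iff'.1 (continuousAt_comp_ofCoord hGc x₀ q₁) (ε / 2)
      (by positivity)
    have e2 := Metric.continuousAt_iff'.1 (continuousAt_comp_extChartAt_symm (n := n) hg x₀ q₁)
      (ε / 2) (by positivity)
    have e3 : ∀ᶠ z : EuclideanSpace ℝ (Fin n) × (EuclideanSpace ℝ (Fin n) →L[ℝ] ℝ) in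
      𝓝 (e x₀, q₀), ContDiffAt ℝ 1 φ z.1 := continuousAt_fst.eventually hφev
    obtain ⟨a, ha, b, hb, χ, χ', hχ, hχ', hm, hm', h1, h2⟩ :=
      hq₀ _ ((hΘc.eventually (e1.and e2)).and e3)
    have hφb : ContDiffAt ℝ 1 φ b := h2.2
    have hder : fderiv ℝ (fun y => t⁻¹ * (φ y - s * χ' y)) b =
        t⁻¹ • (fderiv ℝ φ b - s • fderiv ℝ χ' b) :=
      (((hφb.differentiableAt one_ne_zero).hasFDerivAt.sub
        ((hχ'.contDiffAt.differentiableAt one_ne_zero).hasFDerivAt.const_mul s)).const_mul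
          t⁻¹).fderiv
    have hloc : IsLocalMax (fun y => v (e.symm y) - t⁻¹ * (φ y - s * χ' y)) b := by
      filter_upwards [hm', extChartAt_target_mem_nhds_of_mem hb] with y hy hyt
      simp only [hv', he, (extChartAt (𝓡 n) x₀).right_inv hyt,
        (extChartAt (𝓡 n) x₀).right_inv hb] at hy
      rw [← he] at hy
      have h6 : ∀ y, v (e.symm y) - t⁻¹ * (φ y - s * χ' y) =
          -(s / t) * ((φ y - t * v (e.symm y)) / s - χ' y) := by
        intro y; field_simp; ring
      rw [h6, h6]
      exact mul_le_mul_of_nonpos_left hy (by rw [neg_nonpos]; positivity)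
    have h3 : G (ofCoord x₀ b (t⁻¹ • (fderiv ℝ φ b - s • fderiv ℝ χ' b))) ≤ g (e.symm b) := by
      rw [← hder]
      exact hsubv _ (ofCoord_mem_superjet hb
        (contDiffAt_const.mul (hφb.sub (contDiffAt_const.mul hχ'.contDiffAt))) hloc)
    obtain ⟨⟨h4, h5⟩, -⟩ := h2
    simp only [hΘ, Real.dist_eq, extChartAt_to_inv] at h4 h5
    have h4 := abs_lt.1 h4
    have h5 := abs_lt.1 h5
    linarith [h4.1, h5.2]
  rw [← heq, hcomb]
  have hc := (hconv (e.symm (e x₀))).2 (mem_univ (coordCovector x₀ (e x₀) q₀))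
    (mem_univ (coordCovector x₀ (e x₀) q₁)) hs.le ht.le hst
  rw [← coordCovector_add_smul] at hc
  have hbase : (ofCoord x₀ (e x₀) (s • q₀ + t • q₁)).proj = x₀ := extChartAt_to_inv (I := 𝓡 n) x₀
  rw [hbase]
  refine hc.trans ?_
  exact add_le_add (mul_le_mul_of_nonneg_left hfst hs.le) (mul_le_mul_of_nonneg_left hsnd ht.le)

end Touching

/-! ### The coupling matrix -/

section Coupling

variable {m : ℕ} {B : Matrix (Fin m) (Fin m) ℝ}

theorem mulVec_add_smul_one_apply (B : Matrix (Fin m) (Fin m) ℝ) (l : ℝ) (w : Fin m → ℝ)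
    (i : Fin m) : ((B + l • (1 : Matrix (Fin m) (Fin m) ℝ)).mulVec w) i =
      B.mulVec w i + l * w i := by
  simp [Matrix.add_mulVec, Matrix.smul_mulVec]

theorem mulVec_eq_sum_mul_sub (B_rowsum : ∀ i, ∑ j, B i j = 0) (w : Fin m → ℝ) (i : Fin m)
    (a : ℝ) : B.mulVec w i = ∑ j, B i j * (w j - a) := by
  simp only [Matrix.mulVec, dotProduct, mul_sub, Finset.sum_sub_distrib, ← Finset.sum_mul,
    B_rowsum, zero_mul, sub_zero]

theorem mulVec_const_eq_zero (B_rowsum : ∀ i, ∑ j, B i j = 0) (a : ℝ) (i : Fin m) :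
    B.mulVec (fun _ => a) i = 0 := by
  simp [mulVec_eq_sum_mul_sub B_rowsum _ i a]

theorem mulVec_add_const (B_rowsum : ∀ i, ∑ j, B i j = 0) (w : Fin m → ℝ) (a : ℝ) (i : Fin m) :
    B.mulVec (fun j => w j + a) i = B.mulVec w i := by
  rw [mulVec_eq_sum_mul_sub B_rowsum w i 0, mulVec_eq_sum_mul_sub B_rowsum _ i a]
  simp

theorem mulVec_nonneg_of_forall_le (B_offdiag : ∀ i j, j ≠ i → B i j ≤ 0)
    (B_rowsum : ∀ i, ∑ j, B i j = 0) {w : Fin m → ℝ} {i : Fin m} (h : ∀ j, w j ≤ w i) :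
    0 ≤ B.mulVec w i := by
  rw [mulVec_eq_sum_mul_sub B_rowsum w i (w i)]
  refine Finset.sum_nonneg fun j _ => ?_
  by_cases hj : j = i
  · simp [hj]
  · exact mul_nonneg_of_nonpos_of_nonpos (B_offdiag i j hj) (sub_nonpos.2 (h j))

theorem abs_mulVec_le (B : Matrix (Fin m) (Fin m) ℝ) {w : Fin m → ℝ} {K : ℝ}
    (hw : ∀ j, |w j| ≤ K) (i : Fin m) : |B.mulVec w i| ≤ (∑ i, ∑ j, |B i j|) * K := by
  have hK : 0 ≤ K := (abs_nonneg _).trans (hw i)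
  calc |B.mulVec w i| ≤ ∑ j, |B i j * w j| := by
        rw [Matrix.mulVec, dotProduct]; exact Finset.abs_sum_le_sum_abs _ _
    _ ≤ ∑ j, |B i j| * K := Finset.sum_le_sum fun j _ => by
        rw [abs_mul]; exact mul_le_mul_of_nonneg_left (hw j) (abs_nonneg _)
    _ = (∑ j, |B i j|) * K := by rw [Finset.sum_mul]
    _ ≤ _ := mul_le_mul_of_nonneg_right (Finset.single_le_sum (f := fun i => ∑ j, |B i j|)
        (fun _ _ => Finset.sum_nonneg fun _ _ => abs_nonneg _) (Finset.mem_univ i)) hK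

theorem mulVec_update_le (B_offdiag : ∀ i j, j ≠ i → B i j ≤ 0) {w w' : Fin m → ℝ}
    (h : ∀ j, w j ≤ w' j) (i : Fin m) (a : ℝ) :
    B.mulVec (Function.update w' i a) i ≤ B.mulVec (Function.update w i a) i := by
  simp only [Matrix.mulVec, dotProduct]
  refine Finset.sum_le_sum fun j _ => ?_
  by_cases hj : j = i
  · subst hj; simp
  · simp only [Function.update_of_ne hj]
    exact mul_le_mul_of_nonpos_left (h j) (B_offdiag i j hj)

theorem mulVec_update_apply (B : Matrix (Fin m) (Fin m) ℝ) (w : Fin m → ℝ) (i : Fin m) (a : ℝ) :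
    B.mulVec (Function.update w i a) i = B.mulVec w i + B i i * (a - w i) := by
  have : Function.update w i a = w + Pi.single i (a - w i) := by
    ext j
    by_cases hj : j = i
    · subst hj; simp
    · simp [hj]
  rw [this, Matrix.mulVec_add, Pi.add_apply, Matrix.mulVec_single]
  simp

/-- For an irreducible coupling matrix, an upper bound on `B w` bounds the oscillation of `w`: a
bound on the distance to the maximum is passed on from an index `i` to every `j` with `b_{ij} ≠ 0`.
-/
theorem exists_forall_sub_le_of_mulVec_le (B_offdiag : ∀ i j, j ≠ i → B i j ≤ 0)
    (B_rowsum : ∀ i, ∑ j, B i j = 0)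
    (B_irred : ∀ S : Set (Fin m), S.Nonempty → S ≠ univ → ∃ i ∈ S, ∃ j ∉ S, B i j ≠ 0) (C : ℝ) :
    ∃ K : ℝ, ∀ w : Fin m → ℝ, (∀ i, B.mulVec w i ≤ C) → ∀ i j, |w i - w j| ≤ K := by
  -- starting from the index `k` of the maximum, the set of controlled indices grows to everything
  have hgrow : ∀ (k : Fin m) (N : ℕ), ∃ (S : Finset (Fin m)) (K : ℝ), k ∈ S ∧ 0 ≤ K ∧
      (N < S.card ∨ S = Finset.univ) ∧
      ∀ w : Fin m → ℝ, (∀ i, B.mulVec w i ≤ C) → (∀ j, w j ≤ w k) → ∀ i ∈ S, w k - w i ≤ K := by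
    intro k N
    induction N with
    | zero =>
      refine ⟨{k}, 0, by simp, le_rfl, by simp, fun w _ _ i hi => ?_⟩
      rw [Finset.mem_singleton.1 hi, sub_self]
    | succ N ih =>
      obtain ⟨S, K, hk, hK, hS | hS, h⟩ := ih
      swap
      · exact ⟨S, K, hk, hK, Or.inr hS, h⟩
      by_cases hSu : S = Finset.univ
      · exact ⟨S, K, hk, hK, Or.inr hSu, h⟩
      obtain ⟨i, hi, j, hj, hij⟩ := B_irred (S : Set (Fin m)) ⟨k, hk⟩ (by simpa using hSu)
      simp only [Finset.mem_coe] at hi hj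
      have hneg : B i j < 0 := lt_of_le_of_ne (B_offdiag i j (by rintro rfl; exact hj hi)) hij
      set A := ∑ l, |B i l| with hA
      set K' := K + (|C| + A * K) / (-B i j) with hK'
      have hA0 : 0 ≤ A := Finset.sum_nonneg fun _ _ => abs_nonneg _
      have hKK' : K ≤ K' := by
        have h1 : 0 ≤ (|C| + A * K) / (-B i j) := by
          have : 0 < -B i j := by linarith
          positivity
        linarith
      refine ⟨insert j S, K', Finset.mem_insert_of_mem hk, hK.trans hKK', Or.inl ?_, ?_⟩
      · rw [Finset.card_insert_of_notMem hj]; omega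
      intro w hw hmax l hl
      rcases Finset.mem_insert.1 hl with rfl | hl
      swap
      · exact (h w hw hmax l hl).trans hKK'
      have hwi := h w hw hmax i hi
      have h1 := hw i
      rw [mulVec_eq_sum_mul_sub B_rowsum w i (w i)] at h1
      -- every term of the sum is at least `-|b| K`, and the term of `l` is the one to be bounded
      have h2 : ∀ o ∈ Finset.univ.erase l, -(|B i o| * K) ≤ B i o * (w o - w i) := by
        intro o _
        by_cases hoi : o = i
        · subst hoi; simp only [sub_self, mul_zero, neg_nonpos]; positivity
        · have h3 := B_offdiag i o hoi
          rw [abs_of_nonpos h3]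
          have h4 : w o - w i ≤ K := by linarith [hmax o]
          nlinarith [mul_le_mul_of_nonpos_left h4 h3]
      have h3 := Finset.sum_le_sum h2
      have h4 := Finset.add_sum_erase Finset.univ (fun o => B i o * (w o - w i))
        (Finset.mem_univ l)
      have h5 : ∑ o ∈ Finset.univ.erase l, |B i o| * K ≤ A * K := by
        rw [hA, Finset.sum_mul]
        exact Finset.sum_le_sum_of_subset_of_nonneg (Finset.erase_subset _ _)
          fun _ _ _ => by positivity
      rw [Finset.sum_neg_distrib] at h3
      have h6 : (-B i l) * (w i - w l) ≤ |C| + A * K := by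
        have := le_abs_self C
        have h7 : B i l * (w l - w i) = (-B i l) * (w i - w l) := by ring
        linarith
      have h8 : w i - w l ≤ (|C| + A * K) / (-B i l) := by
        rw [le_div_iff₀ (by linarith)]; linarith
      linarith
  have hall : ∀ k : Fin m, ∃ K : ℝ, 0 ≤ K ∧ ∀ w : Fin m → ℝ, (∀ i, B.mulVec w i ≤ C) →
      (∀ j, w j ≤ w k) → ∀ i, w k - w i ≤ K := by
    intro k
    obtain ⟨S, K, -, hK, hS, h⟩ := hgrow k m
    refine ⟨K, hK, fun w hw hmax i => h w hw hmax i ?_⟩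
    rcases hS with hS | hS
    · have := S.card_le_univ
      rw [Fintype.card_fin] at this
      omega
    · rw [hS]; exact Finset.mem_univ i
  choose K hK0 hK using hall
  refine ⟨∑ k, K k, fun w hw i j => ?_⟩
  obtain ⟨k, -, hk⟩ := Finset.exists_max_image Finset.univ w ⟨i, Finset.mem_univ i⟩
  have hk' : ∀ j, w j ≤ w k := fun j => hk j (Finset.mem_univ j)
  have hle : K k ≤ ∑ k, K k := Finset.single_le_sum (f := K) (fun k _ => hK0 k) (Finset.mem_univ k)
  have h1 := hK k w hw hk' i
  have h2 := hK k w hw hk' j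
  rw [abs_le]
  constructor <;> linarith [hk' i, hk' j]

end Coupling

/-! ### Comparison and stability for systems -/

section Systems

variable {n : ℕ} {M : Type*} [TopologicalSpace M] [ChartedSpace (EuclideanSpace ℝ (Fin n)) M]
  {m : ℕ} {H : Fin m → CotangentBundle n M → ℝ} {B : Matrix (Fin m) (Fin m) ℝ} {l c : ℝ}
  {u v : M → Fin m → ℝ}

/-- Subsolutions in the form of scalar inequalities, with the coupling on the right-hand side. -/
theorem isViscositySubsolution_iff : IsViscositySubsolution H B l c u ↔
    Continuous u ∧ ∀ i, ∀ z ∈ superjet n (fun x => u x i),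
      H i z ≤ c - (B.mulVec (u z.1) i + l * u z.1 i) := by
  simp only [IsViscositySubsolution, mulVec_add_smul_one_apply]
  refine and_congr_right fun _ => ⟨fun h i z hz => ?_, fun h x i p hp => ?_⟩
  · have := h z.1 i z.2 hz
    linarith
  · have := h i ⟨x, p⟩ hp
    linarith

theorem isViscositySupersolution_iff : IsViscositySupersolution H B l c u ↔
    Continuous u ∧ ∀ i, ∀ z ∈ subjet n (fun x => u x i),
      c - (B.mulVec (u z.1) i + l * u z.1 i) ≤ H i z := by
  simp only [IsViscositySupersolution, mulVec_add_smul_one_apply]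
  refine and_congr_right fun _ => ⟨fun h i z hz => ?_, fun h x i p hp => ?_⟩
  · have := h z.1 i z.2 hz
    linarith
  · have := h i ⟨x, p⟩ hp
    linarith

theorem continuous_rhs {M : Type*} [TopologicalSpace M] {m : ℕ} {u : M → Fin m → ℝ}
    (hu : Continuous u) (B : Matrix (Fin m) (Fin m) ℝ) (l c : ℝ) (i : Fin m) :
    Continuous fun x => c - (B.mulVec (u x) i + l * u x i) := by
  exact continuous_const.sub (((continuous_apply i).comp (continuous_const.matrix_mulVec hu)).add
    (continuous_const.mul ((continuous_apply i).comp hu)))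

theorem superdifferential_add_const (f : M → ℝ) (a : ℝ) (x : M) :
    superdifferential n (fun x => f x + a) x = superdifferential n f x := by
  have key : ∀ (g : M → ℝ) (a : ℝ), superdifferential n g x ⊆
      superdifferential n (fun x => g x + a) x := by
    rintro g a p ⟨φ, hφ, hmax, hp⟩
    exact ⟨φ, hφ, by filter_upwards [hmax] with y hy; linarith, hp⟩
  refine subset_antisymm ?_ (key f a)
  simpa using key (fun x => f x + a) (-a)

theorem subdifferential_add_const (f : M → ℝ) (a : ℝ) (x : M) :
    subdifferential n (fun x => f x + a) x = subdifferential n f x := by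
  have key : ∀ (g : M → ℝ) (a : ℝ), subdifferential n g x ⊆
      subdifferential n (fun x => g x + a) x := by
    rintro g a p ⟨φ, hφ, hmin, hp⟩
    exact ⟨φ, hφ, by filter_upwards [hmin] with y hy; linarith, hp⟩
  refine subset_antisymm ?_ (key f a)
  simpa using key (fun x => f x + a) (-a)

theorem IsViscositySubsolution.add_const (B_rowsum : ∀ i, ∑ j, B i j = 0)
    (hu : IsViscositySubsolution H B l c u) (a : ℝ) :
    IsViscositySubsolution H B l (c + l * a) (fun x i => u x i + a) := by
  refine ⟨continuous_pi fun i => ((continuous_apply i).comp hu.1).add continuous_const,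
    fun x i p hp => ?_⟩
  rw [superdifferential_add_const (fun x => u x i)] at hp
  have := hu.2 x i p hp
  rw [mulVec_add_smul_one_apply] at this ⊢
  rw [mulVec_add_const B_rowsum]
  linarith

theorem IsViscositySupersolution.add_const (B_rowsum : ∀ i, ∑ j, B i j = 0)
    (hu : IsViscositySupersolution H B l c u) (a : ℝ) :
    IsViscositySupersolution H B l (c + l * a) (fun x i => u x i + a) := by
  refine ⟨continuous_pi fun i => ((continuous_apply i).comp hu.1).add continuous_const,
    fun x i p hp => ?_⟩
  rw [subdifferential_add_const (fun x => u x i)] at hp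
  have := hu.2 x i p hp
  rw [mulVec_add_smul_one_apply] at this ⊢
  rw [mulVec_add_const B_rowsum]
  linarith

theorem IsViscositySolution.add_const (B_rowsum : ∀ i, ∑ j, B i j = 0)
    (hu : IsViscositySolution H B l c u) (a : ℝ) :
    IsViscositySolution H B l (c + l * a) (fun x i => u x i + a) :=
  ⟨hu.1.add_const B_rowsum a, hu.2.add_const B_rowsum a⟩

variable [IsManifold (𝓡 n) ∞ M]

/-- Comparison principle. For `l = 0` it compares only the right-hand sides: a subsolution for `c`
and a supersolution for `c'` force `c' ≤ c`. -/
theorem mul_sub_le_of_sub_super [CompactSpace M] (H_cont : ∀ i, Continuous (H i))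
    (H_coer : ∀ i, LocallyCoercive (H i)) (B_offdiag : ∀ i j, j ≠ i → B i j ≤ 0)
    (B_rowsum : ∀ i, ∑ j, B i j = 0) {c' : ℝ} (hl : 0 ≤ l)
    (hu : IsViscositySubsolution H B l c u) (hv : IsViscositySupersolution H B l c' v)
    (x : M) (i : Fin m) : l * (u x i - v x i) ≤ c - c' := by
  rw [isViscositySubsolution_iff] at hu
  rw [isViscositySupersolution_iff] at hv
  have hcu : ∀ j, Continuous fun x => u x j := fun j => (continuous_apply j).comp hu.1
  have hcv : ∀ j, Continuous fun x => v x j := fun j => (continuous_apply j).comp hv.1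
  have hmax : ∀ j, ∃ y, ∀ z, u z j - v z j ≤ u y j - v y j := fun j => by
    obtain ⟨y, -, hy⟩ := isCompact_univ.exists_isMaxOn (⟨x, mem_univ x⟩ : (univ : Set M).Nonempty)
      ((hcu j).sub (hcv j)).continuousOn
    exact ⟨y, fun z => hy (mem_univ z)⟩
  choose y hy using hmax
  obtain ⟨k, -, hk⟩ := Finset.exists_max_image Finset.univ
    (fun j => u (y j) j - v (y j) j) ⟨i, Finset.mem_univ i⟩
  have hbig : ∀ z j, u z j - v z j ≤ u (y k) k - v (y k) k := fun z j =>
    (hy j z).trans (hk j (Finset.mem_univ j))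
  have h1 := le_of_isLocalMax_sub (H_cont k) (H_coer k) (hcu k) (hcv k)
    (Eventually.of_forall fun z => hy k z) (continuous_rhs hu.1 B l c k)
    (continuous_rhs hv.1 B l c' k) (hu.2 k) (hv.2 k)
  have h2 := mulVec_nonneg_of_forall_le B_offdiag B_rowsum (w := u (y k) - v (y k)) (i := k)
    (fun j => hbig _ j)
  rw [Matrix.mulVec_sub, Pi.sub_apply] at h2
  have h3 := mul_le_mul_of_nonneg_left (hbig x i) hl
  linarith

/-- Stability of subsolutions under uniform convergence of the functions and the data. -/
theorem isViscositySubsolution_of_forall_approx (H_cont : ∀ i, Continuous (H i))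
    (hu : Continuous u)
    (h : ∀ ε > 0, ∃ (l' c' : ℝ) (w : M → Fin m → ℝ), IsViscositySubsolution H B l' c' w ∧
      (∀ x i, |w x i - u x i| ≤ ε) ∧ ∀ x i, |(c' - (B.mulVec (w x) i + l' * w x i)) -
        (c - (B.mulVec (u x) i + l * u x i))| ≤ ε) :
    IsViscositySubsolution H B l c u := by
  rw [isViscositySubsolution_iff]
  refine ⟨hu, fun i z₀ hz₀ => ?_⟩
  by_contra! hcon
  set F : CotangentBundle n M → ℝ := fun z => H i z - (c - (B.mulVec (u z.1) i + l * u z.1 i))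
    with hF
  have hFc : Continuous F := (H_cont i).sub ((continuous_rhs hu B l c i).comp
    (FiberBundle.continuous_proj _ _))
  have hF0 : 0 < F z₀ := sub_pos.2 hcon
  have hN : ∀ᶠ z in 𝓝 z₀, F z₀ / 2 < F z := hFc.continuousAt.eventually_const_lt (by linarith)
  obtain ⟨η, hη, hst⟩ := exists_mem_superjet_of_le_add ((continuous_apply i).comp hu) hz₀ hN one_pos
  obtain ⟨l', c', w, hw, hwu, hrhs⟩ := h (min η (F z₀ / 2)) (by positivity)
  rw [isViscositySubsolution_iff] at hw
  have hle : ∀ x i, |w x i - u x i| ≤ η := fun x i => (hwu x i).trans (min_le_left _ _)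
  obtain ⟨z, hz, hzN, -⟩ := hst (fun x => w x i) ((continuous_apply i).comp hw.1)
    (fun x => by have := abs_le.1 (hle x i); simp only [Function.comp_apply]; linarith [this.2])
    (by have := abs_le.1 (hle z₀.1 i); simp only [Function.comp_apply]; linarith [this.1])
  have h1 := hw.2 i z hz
  have h2 := abs_le.1 ((hrhs z.1 i).trans (min_le_right _ _))
  have h3 : F z₀ / 2 < H i z - (c - (B.mulVec (u z.1) i + l * u z.1 i)) := hzN
  linarith [h2.2]

theorem isViscositySupersolution_of_forall_approx (H_cont : ∀ i, Continuous (H i))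
    (hu : Continuous u)
    (h : ∀ ε > 0, ∃ (l' c' : ℝ) (w : M → Fin m → ℝ), IsViscositySupersolution H B l' c' w ∧
      (∀ x i, |w x i - u x i| ≤ ε) ∧ ∀ x i, |(c' - (B.mulVec (w x) i + l' * w x i)) -
        (c - (B.mulVec (u x) i + l * u x i))| ≤ ε) :
    IsViscositySupersolution H B l c u := by
  rw [isViscositySupersolution_iff]
  refine ⟨hu, fun i z₀ hz₀ => ?_⟩
  by_contra! hcon
  set F : CotangentBundle n M → ℝ := fun z => (c - (B.mulVec (u z.1) i + l * u z.1 i)) - H i z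
    with hF
  have hFc : Continuous F := ((continuous_rhs hu B l c i).comp
    (FiberBundle.continuous_proj _ _)).sub (H_cont i)
  have hF0 : 0 < F z₀ := sub_pos.2 hcon
  have hN : ∀ᶠ z in 𝓝 z₀, F z₀ / 2 < F z := hFc.continuousAt.eventually_const_lt (by linarith)
  obtain ⟨η, hη, hst⟩ := exists_mem_subjet_of_abs_sub_le ((continuous_apply i).comp hu) hz₀ hN
  obtain ⟨l', c', w, hw, hwu, hrhs⟩ := h (min η (F z₀ / 2)) (by positivity)
  rw [isViscositySupersolution_iff] at hw
  obtain ⟨z, hz, hzN⟩ := hst (fun x => w x i) ((continuous_apply i).comp hw.1)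
    (fun x => (hwu x i).trans (min_le_left _ _))
  have h1 := hw.2 i z hz
  have h2 := abs_le.1 ((hrhs z.1 i).trans (min_le_right _ _))
  have h3 : F z₀ / 2 < (c - (B.mulVec (u z.1) i + l * u z.1 i)) - H i z := hzN
  linarith [h2.1]

end Systems

/-! ### Perron's method -/

section Perron

variable {n : ℕ} {M : Type*} [TopologicalSpace M] [ChartedSpace (EuclideanSpace ℝ (Fin n)) M]
  [IsManifold (𝓡 n) ∞ M]
  {m : ℕ} {H : Fin m → CotangentBundle n M → ℝ} {B : Matrix (Fin m) (Fin m) ℝ} {l c : ℝ}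

/-- Separation of the diagonal term: the `i`-th component of `B w` is an expression that is monotone
in the other components of `w`, plus `b_{ii} w_i`. -/
theorem mulVec_eq_update_zero (B : Matrix (Fin m) (Fin m) ℝ) (w : Fin m → ℝ) (i : Fin m) :
    B.mulVec w i = B.mulVec (Function.update w i 0) i + B i i * w i := by
  rw [mulVec_update_apply]
  ring

theorem mulVec_update_zero_antitone (B_offdiag : ∀ i j, j ≠ i → B i j ≤ 0) {w w' : Fin m → ℝ}
    (i : Fin m) (h : ∀ j, j ≠ i → w j ≤ w' j) :
    B.mulVec (Function.update w' i 0) i ≤ B.mulVec (Function.update w i 0) i := by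
  have key := mulVec_update_le (w := Function.update w i 0) (w' := Function.update w' i 0)
    B_offdiag (fun j => ?_) i 0
  · simpa using key
  · by_cases hj : j = i
    · subst hj; simp
    · simpa [hj] using h j hj

omit [IsManifold (𝓡 n) ∞ M] [ChartedSpace (EuclideanSpace ℝ (Fin n)) M] in
theorem continuous_mulVec_update_zero {u : M → Fin m → ℝ} (hu : Continuous u)
    (B : Matrix (Fin m) (Fin m) ℝ) (i : Fin m) :
    Continuous fun x => B.mulVec (Function.update (u x) i 0) i :=
  (continuous_apply i).comp (continuous_const.matrix_mulVec (hu.update i continuous_const))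

theorem isViscositySubsolution_const (B_rowsum : ∀ i, ∑ j, B i j = 0) {a : ℝ}
    (h : ∀ (i : Fin m) (x : M), H i ⟨x, 0⟩ + l * a ≤ c) :
    IsViscositySubsolution H B l c (fun _ _ => a) := by
  rw [isViscositySubsolution_iff]
  refine ⟨continuous_const, fun i z hz => ?_⟩
  rw [eq_zero_of_mem_superjet_const hz, mulVec_const_eq_zero B_rowsum]
  linarith [h i z.1]

theorem isViscositySupersolution_const (B_rowsum : ∀ i, ∑ j, B i j = 0) {a : ℝ}
    (h : ∀ (i : Fin m) (x : M), c ≤ H i ⟨x, 0⟩ + l * a) :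
    IsViscositySupersolution H B l c (fun _ _ => a) := by
  rw [isViscositySupersolution_iff]
  refine ⟨continuous_const, fun i z hz => ?_⟩
  rw [eq_zero_of_mem_subjet_const hz, mulVec_const_eq_zero B_rowsum]
  linarith [h i z.1]

/-- The bump construction of Perron's method: a subsolution whose `i`-th component violates the
supersolution inequality at some point can be increased there. Only this component changes, which by
the sign of the coupling preserves the inequalities for the others. -/
theorem exists_larger_subsolution [T2Space M] (H_cont : ∀ i, Continuous (H i))
    (B_offdiag : ∀ i j, j ≠ i → B i j ≤ 0) {u : M → Fin m → ℝ}
    (hu : IsViscositySubsolution H B l c u) {i : Fin m} {z₀ : CotangentBundle n M}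
    (hz₀ : z₀ ∈ subjet n (fun x => u x i))
    (hlt : H i z₀ < c - (B.mulVec (u z₀.1) i + l * u z₀.1 i)) :
    ∃ w : M → Fin m → ℝ, IsViscositySubsolution H B l c w ∧ (∀ x j, u x j ≤ w x j) ∧
      u z₀.1 i < w z₀.1 i := by
  rw [isViscositySubsolution_iff] at hu
  obtain ⟨x₀, p⟩ := z₀
  obtain ⟨φ, hφ, hmin, heq⟩ := exists_coord_of_mem_subdifferential hz₀
  have hlim := tendsto_extChartAt_symm (n := n) x₀
  have hleft := extChartAt_to_inv (I := 𝓡 n) x₀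
  rw [← heq] at hlt
  change _ < c - (B.mulVec (u ((extChartAt (𝓡 n) x₀).symm (extChartAt (𝓡 n) x₀ x₀))) i + _) at hlt
  set e := extChartAt (𝓡 n) x₀ with he
  have htgt : ∀ᶠ y in 𝓝 (e x₀), y ∈ e.target := extChartAt_target_mem_nhds x₀
  set y₀ := e x₀ with hy₀
  have hcu : ∀ j, Continuous fun x => u x j := fun j => (continuous_apply j).comp hu.1
  -- the bump, up to a small additive constant; it is strictly below `u_i` except at `y₀`
  set ψ : EuclideanSpace ℝ (Fin n) → ℝ := fun y => φ y + -1 * ‖y - y₀‖ ^ 2 with hψ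
  have hψC : ContDiffAt ℝ 1 ψ y₀ := hφ.add (contDiff_const_mul_norm_sub_sq (-1) y₀).contDiffAt
  have hψd : fderiv ℝ ψ y₀ = fderiv ℝ φ y₀ := by
    have := ((hφ.differentiableAt one_ne_zero).hasFDerivAt.add
      (hasFDerivAt_const_mul_norm_sub_sq (-1) y₀ y₀)).fderiv
    rw [sub_self, map_zero, smul_zero, add_zero] at this
    exact this
  have hψ0 : ψ y₀ = φ y₀ := by simp [hψ]
  set a := u x₀ i - φ y₀ with ha
  set O : M → ℝ := fun x => B.mulVec (Function.update (u x) i 0) i with hO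
  have hOc : Continuous O := continuous_mulVec_update_zero hu.1 B i
  -- the left-hand side of the equation at the bump, smaller than `c` near `y₀`
  set Λ : EuclideanSpace ℝ (Fin n) → ℝ := fun y =>
    H i (ofCoord x₀ y (fderiv ℝ ψ y)) + O (e.symm y) + (B i i + l) * (ψ y + a) with hΛ
  have hΛc : ContinuousAt Λ y₀ := by
    have h1 : ContinuousAt (fun y => (y, fderiv ℝ ψ y)) y₀ :=
      continuousAt_id.prodMk (hψC.continuousAt_fderiv one_ne_zero)
    have h2 : ContinuousAt (fun y => H i (ofCoord x₀ y (fderiv ℝ ψ y))) y₀ :=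
      (continuousAt_comp_ofCoord (H_cont i) x₀ (fderiv ℝ ψ y₀)).comp
        (f := fun y => (y, fderiv ℝ ψ y)) h1
    have h3 : ContinuousAt (fun y => O (e.symm y)) y₀ :=
      ContinuousAt.comp (f := e.symm) hOc.continuousAt (continuousAt_extChartAt_symm x₀)
    exact (h2.add h3).add (continuousAt_const.mul (hψC.continuousAt.add continuousAt_const))
  have hΛ0 : Λ y₀ < c := by
    simp only [hΛ, hO, hψd, hψ0, ha]
    rw [hleft] at hlt ⊢
    rw [mulVec_eq_update_zero B (u x₀) i] at hlt
    change _ < c - (_ + l * u (e.symm y₀) i) at hlt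
    rw [hleft] at hlt
    linarith
  set ε := (c - Λ y₀) / 2 with hε
  have hε0 : 0 < ε := by rw [hε]; linarith
  have hΛev : ∀ᶠ y in 𝓝 y₀, Λ y < c - ε := hΛc.eventually_lt_const (by rw [hε]; linarith)
  have hψev : ∀ᶠ y in 𝓝 y₀, ContDiffAt ℝ 1 ψ y := hψC.eventually (by simp)
  obtain ⟨r, hr, hball⟩ := Metric.nhds_basis_closedBall.eventually_iff.1
    (((htgt.and hmin).and hΛev).and hψev)
  set δ := min (r ^ 2 / 4) (ε / (|B i i + l| + 1)) with hδ
  have hδ0 : 0 < δ := by positivity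
  have hδ1 : δ ≤ r ^ 2 / 4 := min_le_left _ _
  have hδ2 : (B i i + l) * δ ≤ ε := by
    have h1 : δ ≤ ε / (|B i i + l| + 1) := min_le_right _ _
    rw [le_div_iff₀ (by positivity)] at h1
    nlinarith [le_abs_self (B i i + l)]
  set V : Set M := e.source ∩ e ⁻¹' Metric.ball y₀ r with hV
  have hVo : IsOpen V := isOpen_extChartAt_preimage' x₀ Metric.isOpen_ball
  set b : M → ℝ := fun x => ψ (e x) + a + δ with hb
  open Classical in
  set g : M → ℝ := fun x => if x ∈ V then max (u x i) (b x) else u x i with hg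
  have hgV : ∀ x ∈ V, g x = max (u x i) (b x) := fun x hx => if_pos hx
  have hgV' : ∀ x ∉ V, g x = u x i := fun x hx => if_neg hx
  have hug : ∀ x, u x i ≤ g x := fun x => by
    by_cases hx : x ∈ V
    · rw [hgV x hx]; exact le_max_left _ _
    · rw [hgV' x hx]
  have hVball : ∀ x ∈ V, e x ∈ Metric.closedBall y₀ r := fun x hx =>
    Metric.ball_subset_closedBall hx.2
  have hbc : ∀ x ∈ V, ContinuousAt b x := fun x hx =>
    (((hball (hVball x hx)).2.continuousAt.comp (f := e)
      (continuousAt_extChartAt' hx.1)).add continuousAt_const).add continuousAt_const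
  -- away from a smaller ball the bump lies below `u`
  have hbu : ∀ x ∈ V, r / 2 ≤ ‖e x - y₀‖ → b x ≤ u x i := by
    intro x hx hxr
    have h1 := (hball (hVball x hx)).1.1.2
    simp only at h1
    rw [hleft, e.left_inv hx.1] at h1
    have h2 : (r / 2) ^ 2 ≤ ‖e x - y₀‖ ^ 2 := pow_le_pow_left₀ (by positivity) hxr 2
    simp only [hb, hψ, ha]
    linarith
  set Q : Set M := e.symm '' Metric.closedBall y₀ (r / 2) with hQ
  have hQt : Metric.closedBall y₀ (r / 2) ⊆ e.target := fun y hy =>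
    (hball (Metric.closedBall_subset_closedBall (by linarith) hy)).1.1.1
  have hQc : IsClosed Q := ((isCompact_closedBall _ _).image_of_continuousOn
    ((continuousOn_extChartAt_symm x₀).mono hQt)).isClosed
  have hQV : Q ⊆ V := by
    rintro _ ⟨y, hy, rfl⟩
    refine ⟨e.map_target (hQt hy), ?_⟩
    rw [mem_preimage, e.right_inv (hQt hy)]
    exact Metric.closedBall_subset_ball (by linarith) hy
  have hgQ : ∀ x ∉ Q, g x = u x i := fun x hx => by
    by_cases hxV : x ∈ V
    · rw [hgV x hxV]
      refine max_eq_left (hbu x hxV ?_)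
      by_contra! hcon
      refine hx ⟨e x, ?_, e.left_inv hxV.1⟩
      rw [Metric.mem_closedBall, dist_eq_norm]
      exact hcon.le
    · exact hgV' x hxV
  have hgc : Continuous g := by
    rw [continuous_iff_continuousAt]
    intro x
    by_cases hx : x ∈ Q
    · have h3 : ContinuousAt (fun y => max (u y i) (b y)) x :=
        (hcu i).continuousAt.max (hbc x (hQV hx))
      refine h3.congr ?_
      filter_upwards [hVo.mem_nhds (hQV hx)] with y hy
      rw [hgV y hy]
    · refine (hcu i).continuousAt.congr ?_
      filter_upwards [hQc.isOpen_compl.mem_nhds hx] with y hy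
      rw [hgQ y hy]
  refine ⟨fun x => Function.update (u x) i (g x), ?_, ?_, ?_⟩
  · rw [isViscositySubsolution_iff]
    refine ⟨continuous_pi fun j => ?_, fun j z hz => ?_⟩
    · by_cases hj : j = i
      · subst hj; simpa using hgc
      · simpa [hj] using hcu j
    by_cases hj : j = i
    · subst hj
      simp only [Function.update_self] at hz ⊢
      rw [mulVec_eq_update_zero, Function.update_idem, Function.update_self]
      by_cases hcase : z.1 ∈ V ∧ u z.1 j ≤ b z.1
      · obtain ⟨hzV, hle⟩ := hcase
        have hgz : g z.1 = b z.1 := by rw [hgV _ hzV, max_eq_right hle]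
        have hbz := hball (hVball _ hzV)
        have hdiff : DifferentiableAt ℝ (fun y => ψ y + (a + δ)) (e z.1) :=
          (hbz.2.differentiableAt one_ne_zero).add_const _
        have hzeq := eq_ofCoord_of_mem_superjet hz hzV.1 hdiff
          (by
            filter_upwards [hVo.mem_nhds hzV] with y hy
            rw [hgV y hy, ← add_assoc]
            exact le_max_right _ _)
          (by rw [hgz, ← add_assoc])
        rw [fderiv_add_const] at hzeq
        have h1 := hbz.1.2
        simp only [hΛ] at h1
        rw [← he] at hzeq
        rw [← hzeq, e.left_inv hzV.1] at h1
        rw [hgz]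
        simp only [hb, hO] at h1 ⊢
        linarith
      · have hgz : g z.1 = u z.1 j := by
          by_cases hzV : z.1 ∈ V
          · rw [hgV _ hzV]
            exact max_eq_left (not_le.1 fun h => hcase ⟨hzV, h⟩).le
          · exact hgV' _ hzV
        have hz' : z ∈ superjet n (fun x => u x j) :=
          superdifferential_subset_of_le (Eventually.of_forall hug) hgz.symm hz
        have := hu.2 j z hz'
        rw [mulVec_eq_update_zero] at this
        rw [hgz]
        linarith
    · simp only [Function.update_of_ne hj] at hz ⊢
      have h1 := hu.2 j z hz
      rw [mulVec_eq_update_zero] at h1 ⊢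
      rw [Function.update_of_ne hj]
      have h2 := mulVec_update_zero_antitone B_offdiag (w := u z.1)
        (w' := Function.update (u z.1) i (g z.1)) j (fun k _ => by
          by_cases hk : k = i
          · subst hk; simpa using hug z.1
          · simp [hk])
      linarith
  · intro x j
    by_cases hj : j = i
    · subst hj; simpa using hug x
    · simp [hj]
  · have hx₀V : x₀ ∈ V := ⟨mem_extChartAt_source x₀, Metric.mem_ball_self hr⟩
    simp only [Function.update_self]
    rw [hgV x₀ hx₀V]
    refine lt_of_lt_of_le ?_ (le_max_right _ _)
    simp only [hb, ← hy₀, hψ0, ha]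
    linarith

omit [IsManifold (𝓡 n) ∞ M] in
/-- Bounded subsolutions satisfy scalar inequalities with a uniform right-hand side, and are
therefore equicontinuous for coercive Hamiltonians. -/
theorem IsViscositySubsolution.exists_forall_le {K : ℝ} (hl : 0 ≤ l) {w : M → Fin m → ℝ}
    (hw : IsViscositySubsolution H B l c w) (hK : ∀ x i, |w x i| ≤ K) (i : Fin m) :
    ∀ z ∈ superjet n (fun x => w x i), H i z ≤ |c| + (∑ i, ∑ j, |B i j|) * K + l * K := by
  intro z hz
  have h1 := (isViscositySubsolution_iff.1 hw).2 i z hz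
  have h2 := abs_le.1 (abs_mulVec_le B (hK z.1) i)
  have h3 := abs_le.1 (hK z.1 i)
  have h4 := mul_le_mul_of_nonneg_left h3.1 hl
  linarith [le_abs_self c, h2.1]

/-- Existence for the discounted system: the supremum of the subsolutions between the constants `-K`
and `K` is a solution. -/
theorem exists_isViscositySolution [T2Space M] [CompactSpace M] [Nonempty M]
    (H_cont : ∀ i, Continuous (H i)) (H_coer : ∀ i, LocallyCoercive (H i))
    (B_offdiag : ∀ i j, j ≠ i → B i j ≤ 0) (B_rowsum : ∀ i, ∑ j, B i j = 0) {C₀ : ℝ}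
    (hC₀ : ∀ (i : Fin m) (x : M), |H i ⟨x, 0⟩| ≤ C₀) (hl : 0 < l) (c : ℝ) :
    ∃ u, IsViscositySolution H B l c u := by
  set K := (|C₀| + |c|) / l with hK
  have hlK : l * K = |C₀| + |c| := by rw [hK]; field_simp
  have hK0 : 0 ≤ K := by positivity
  have hsubK : IsViscositySubsolution H B l c (fun (_ : M) _ => -K) :=
    isViscositySubsolution_const B_rowsum fun i x => by
      have := (abs_le.1 (hC₀ i x)).2
      linarith [le_abs_self C₀, neg_abs_le c]
  have hsupK : IsViscositySupersolution H B l c (fun (_ : M) _ => K) :=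
    isViscositySupersolution_const B_rowsum fun i x => by
      have := (abs_le.1 (hC₀ i x)).1
      linarith [le_abs_self C₀, le_abs_self c]
  have hleK : ∀ w, IsViscositySubsolution H B l c w → ∀ x i, w x i ≤ K := fun w hw x i => by
    have h1 := mul_sub_le_of_sub_super H_cont H_coer B_offdiag B_rowsum hl.le hw hsupK x i
    rw [sub_self] at h1
    have := nonpos_of_mul_nonpos_right h1 hl
    linarith
  set S : Set (M → Fin m → ℝ) := {w | IsViscositySubsolution H B l c w ∧ ∀ x i, -K ≤ w x i}
    with hS
  have hne : Nonempty S := ⟨⟨_, hsubK, fun _ _ => le_rfl⟩⟩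
  -- comparison with the constant supersolution `K` bounds the supremum, so it is not a junk value
  set u : M → Fin m → ℝ := fun x i => ⨆ w : S, w.1 x i with hu
  have hbdd : ∀ x i, BddAbove (range fun w : S => w.1 x i) := fun x i =>
    ⟨K, by rintro _ ⟨w, rfl⟩; exact hleK w.1 w.2.1 x i⟩
  have hle : ∀ w ∈ S, ∀ x i, w x i ≤ u x i := fun w hw x i =>
    le_ciSup (hbdd x i) (⟨w, hw⟩ : S)
  have habs : ∀ w ∈ S, ∀ x i, |w x i| ≤ K := fun w hw x i =>
    abs_le.2 ⟨hw.2 x i, hleK w hw.1 x i⟩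
  have hucont : Continuous u := by
    refine continuous_pi fun i => continuous_iff_continuousAt.2 fun x₀ => ?_
    rw [Metric.continuousAt_iff']
    intro ε hε
    obtain ⟨V, hV, h⟩ := exists_nhds_abs_sub_le (H_coer i)
      (|c| + (∑ i, ∑ j, |B i j|) * K + l * K) x₀ (half_pos hε)
    filter_upwards [hV] with x hx
    have hw : ∀ w : S, |w.1 x i - w.1 x₀ i| ≤ ε / 2 := fun w =>
      h (fun x => w.1 x i) ((continuous_apply i).comp w.2.1.1)
        (w.2.1.exists_forall_le hl.le (habs w.1 w.2) i) x hx
    have h1 : u x i ≤ u x₀ i + ε / 2 := ciSup_le fun w => by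
      linarith [(abs_le.1 (hw w)).2, hle w.1 w.2 x₀ i]
    have h2 : u x₀ i ≤ u x i + ε / 2 := ciSup_le fun w => by
      linarith [(abs_le.1 (hw w)).1, hle w.1 w.2 x i]
    rw [Real.dist_eq, abs_lt]
    constructor <;> linarith
  have husub : IsViscositySubsolution H B l c u := by
    rw [isViscositySubsolution_iff]
    refine ⟨hucont, fun i z₀ hz₀ => ?_⟩
    by_contra! hcon
    set O : M → ℝ := fun x => B.mulVec (Function.update (u x) i 0) i with hO
    have hui : Continuous fun x => u x i := (continuous_apply i).comp hucont
    have hOc : Continuous O := continuous_mulVec_update_zero hucont B i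
    set F : CotangentBundle n M → ℝ := fun z => H i z + O z.1 with hF
    have hFc : Continuous F := (H_cont i).add (hOc.comp (FiberBundle.continuous_proj _ _))
    set ε := (F z₀ + (B i i + l) * u z₀.1 i - c) / 2 with hε
    have hε0 : 0 < ε := by
      rw [mulVec_eq_update_zero] at hcon
      simp only [hε, hF, hO]
      linarith
    have hN : ∀ᶠ z in 𝓝 z₀, F z₀ - ε < F z := hFc.continuousAt.eventually_const_lt (by linarith)
    set δ := ε / (|B i i + l| + 1) with hδ
    obtain ⟨η, hη, hst⟩ := exists_mem_superjet_of_le_add hui hz₀ hN (show 0 < δ by positivity)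
    obtain ⟨w, hw⟩ := exists_lt_of_lt_ciSup (show u z₀.1 i - η < ⨆ w : S, w.1 z₀.1 i by
      simp only [hu]; linarith)
    obtain ⟨z, hz, hzN, hzδ⟩ := hst (fun x => w.1 x i) ((continuous_apply i).comp w.2.1.1)
      (fun x => by have := hle w.1 w.2 x i; linarith) hw.le
    have h1 := (isViscositySubsolution_iff.1 w.2.1).2 i z hz
    have h2 := mulVec_update_zero_antitone B_offdiag i (w := w.1 z.1) (w' := u z.1)
      fun j _ => hle w.1 w.2 z.1 j
    rw [mulVec_eq_update_zero] at h1
    have h3 : F z₀ - ε < H i z + B.mulVec (Function.update (u z.1) i 0) i := hzN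
    have h4 : |(B i i + l) * (w.1 z.1 i - u z₀.1 i)| ≤ ε := by
      rw [abs_mul]
      have h5 : δ * (|B i i + l| + 1) = ε := by rw [hδ]; field_simp
      nlinarith [abs_nonneg (B i i + l), mul_le_mul_of_nonneg_left hzδ.le (abs_nonneg (B i i + l))]
    have h5 := (abs_le.1 h4).1
    have h6 : 2 * ε = F z₀ + (B i i + l) * u z₀.1 i - c := by rw [hε]; ring
    linarith
  have hugeK : ∀ x i, -K ≤ u x i := fun x i => hle _ ⟨hsubK, fun _ _ => le_rfl⟩ x i
  refine ⟨u, husub, ?_⟩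
  rw [isViscositySupersolution_iff]
  refine ⟨hucont, fun i z₀ hz₀ => ?_⟩
  by_contra! hcon
  obtain ⟨w, hw, huw, hlt⟩ := exists_larger_subsolution H_cont B_offdiag husub hz₀ hcon
  exact absurd (hle w ⟨hw, fun x j => (hugeK x j).trans (huw x j)⟩ z₀.1 i) (not_le.2 hlt)

end Perron

/-! ### Lower bound of a coercive Hamiltonian -/

section LowerBound

variable {n : ℕ} {M : Type*} [TopologicalSpace M] [ChartedSpace (EuclideanSpace ℝ (Fin n)) M]
  [IsManifold (𝓡 n) ∞ M]

/-- Every covector over the domain of the chart is given by coordinates. -/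
theorem exists_eq_ofCoord {x₀ : M} {z : CotangentBundle n M}
    (hz : z.1 ∈ (extChartAt (𝓡 n) x₀).source) :
    ∃ q, z = ofCoord x₀ (extChartAt (𝓡 n) x₀ z.1) q := by
  obtain ⟨x, p⟩ := z
  obtain ⟨y, hy, rfl⟩ : ∃ y ∈ (extChartAt (𝓡 n) x₀).target, (extChartAt (𝓡 n) x₀).symm y = x :=
    ⟨_, (extChartAt (𝓡 n) x₀).map_source hz, (extChartAt (𝓡 n) x₀).left_inv hz⟩
  have hb : (extChartAt (𝓡 n) x₀).symm y ∈ (trivializationAt (EuclideanSpace ℝ (Fin n))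
      (TangentSpace (𝓡 n) : M → Type _) x₀).baseSet := by
    have := hz
    rw [extChartAt_source] at this
    exact this
  refine ⟨p ∘L (trivializationAt (EuclideanSpace ℝ (Fin n)) (TangentSpace (𝓡 n) : M → Type _)
      x₀).symmL ℝ ((extChartAt (𝓡 n) x₀).symm y), ?_⟩
  rw [(extChartAt (𝓡 n) x₀).right_inv hy, ofCoord]
  refine congrArg (fun q => (⟨(extChartAt (𝓡 n) x₀).symm y, q⟩ : CotangentBundle n M)) ?_
  ext v
  exact congrArg p (Trivialization.symmL_continuousLinearMapAt _ hb v).symm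

/-- A continuous coercive Hamiltonian on a compact manifold is bounded below. -/
theorem exists_forall_ge_of_locallyCoercive [CompactSpace M] {G : CotangentBundle n M → ℝ}
    (hGc : Continuous G) (hG : LocallyCoercive G) : ∃ L : ℝ, ∀ z, -L ≤ G z := by
  have hloc : ∀ x₀ : M, ∃ V ∈ 𝓝 x₀, ∃ L : ℝ, 0 ≤ L ∧ ∀ z : CotangentBundle n M, z.1 ∈ V →
      -L ≤ G z := by
    intro x₀
    set e := extChartAt (𝓡 n) x₀ with he
    have htgt : ∀ᶠ y in 𝓝 (e x₀), y ∈ e.target := extChartAt_target_mem_nhds x₀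
    obtain ⟨R, hR, hRev⟩ := hG x₀ 0
    obtain ⟨r, hr, hball⟩ := Metric.nhds_basis_closedBall.eventually_iff.1 (htgt.and hRev)
    have hcont : ContinuousOn (fun z : EuclideanSpace ℝ (Fin n) ×
        (EuclideanSpace ℝ (Fin n) →L[ℝ] ℝ) => G (ofCoord x₀ z.1 z.2))
        (Metric.closedBall (e x₀) r ×ˢ Metric.closedBall 0 R) := fun z hz =>
      (hGc.continuousAt.comp (f := fun z : EuclideanSpace ℝ (Fin n) ×
        (EuclideanSpace ℝ (Fin n) →L[ℝ] ℝ) => ofCoord x₀ z.1 z.2)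
        (continuousAt_ofCoord (hball hz.1).1 z.2)).continuousWithinAt
    obtain ⟨L, hL⟩ := ((isCompact_closedBall _ _).prod
      (isCompact_closedBall _ _)).exists_bound_of_continuousOn hcont
    refine ⟨e.source ∩ e ⁻¹' Metric.closedBall (e x₀) r, inter_mem (extChartAt_source_mem_nhds x₀)
      ((continuousAt_extChartAt (I := 𝓡 n) x₀) (Metric.closedBall_mem_nhds _ hr)), |L|,
      abs_nonneg _, ?_⟩
    rintro z ⟨hz1, hz2⟩
    obtain ⟨q, hq⟩ := exists_eq_ofCoord hz1
    rw [hq]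
    by_cases hle : G (ofCoord x₀ (e z.1) q) ≤ 0
    · have h1 := hL (e z.1, q) ⟨hz2, by
        rw [mem_closedBall_zero_iff]; exact (hball hz2).2 q hle⟩
      rw [Real.norm_eq_abs] at h1
      linarith [(abs_le.1 (h1.trans (le_abs_self L))).1]
    · linarith [abs_nonneg L]
  choose V hV L hL0 hL using hloc
  obtain ⟨t, -, ht⟩ := isCompact_univ.elim_nhds_subcover V fun x _ => hV x
  refine ⟨∑ y ∈ t, L y, fun z => ?_⟩
  obtain ⟨y, hyt, hzy⟩ := mem_iUnion₂.1 (ht (mem_univ z.1))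
  have h1 := hL y z hzy
  have h2 := Finset.single_le_sum (f := L) (fun y _ => hL0 y) hyt
  linarith

end LowerBound

/-! ### Compactness of families of subsolutions -/

section Compactness

open BoundedContinuousFunction

variable {n : ℕ} {M : Type*} [TopologicalSpace M] [ChartedSpace (EuclideanSpace ℝ (Fin n)) M]
  {m : ℕ} {H : Fin m → CotangentBundle n M → ℝ} {B : Matrix (Fin m) (Fin m) ℝ}

theorem abs_apply_sub_le_dist (f g : M →ᵇ (Fin m → ℝ)) (x : M) (i : Fin m) :
    |f x i - g x i| ≤ dist f g := by
  rw [← Real.dist_eq]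
  exact (dist_le_pi_dist _ _ i).trans (dist_coe_le_dist x)

variable [IsManifold (𝓡 n) ∞ M]

/-- The functions with components bounded by `K` which satisfy `H_i(x, D f_i) ≤ C`, as a set of
bounded continuous functions in order to use the theorem of Arzelà and Ascoli. -/
def subsolutionFamily (H : Fin m → CotangentBundle n M → ℝ) (K C : ℝ) :
    Set (M →ᵇ (Fin m → ℝ)) :=
  {f | (∀ x i, |f x i| ≤ K) ∧ ∀ i, ∀ z ∈ superjet n (fun x => f x i), H i z ≤ C}

/-- The theorem of Arzelà and Ascoli for the equicontinuous family of bounded subsolutions. -/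
theorem isCompact_closure_subsolutionFamily [CompactSpace M] (H_coer : ∀ i, LocallyCoercive (H i))
    (K C : ℝ) : IsCompact (closure (subsolutionFamily H K C)) := by
  refine arzela_ascoli (Metric.closedBall 0 |K|) (isCompact_closedBall _ _) _ (fun f x hf => ?_) ?_
  · rw [mem_closedBall_zero_iff, pi_norm_le_iff_of_nonneg (abs_nonneg _)]
    exact fun i => (hf.1 x i).trans (le_abs_self K)
  · intro x₀
    rw [Metric.equicontinuousAt_iff_right]
    intro ε hε
    have h : ∀ i, ∀ᶠ x in 𝓝 x₀, ∀ f : subsolutionFamily H K C, |f.1 x i - f.1 x₀ i| ≤ ε / 2 := by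
      intro i
      obtain ⟨V, hV, h⟩ := exists_nhds_abs_sub_le (H_coer i) C x₀ (half_pos hε)
      filter_upwards [hV] with x hx f
      exact h (fun x => f.1 x i) ((continuous_apply i).comp f.1.continuous) (f.2.2 i) x hx
    filter_upwards [eventually_all.2 h] with x hx f
    refine lt_of_le_of_lt ?_ (half_lt_self hε)
    rw [dist_pi_le_iff (half_pos hε).le]
    intro i
    rw [dist_comm, Real.dist_eq]
    exact hx i f

/-- Stability of solutions under uniform convergence. -/
theorem isViscositySolution_of_tendsto (H_cont : ∀ i, Continuous (H i)) {ι : Type*}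
    {F : Filter ι} [F.NeBot] {f : ι → M →ᵇ (Fin m → ℝ)} {f₀ : M →ᵇ (Fin m → ℝ)} {l c : ι → ℝ}
    {l₀ c₀ : ℝ} (hf : Tendsto f F (𝓝 f₀)) (hl : Tendsto l F (𝓝 l₀)) (hc : Tendsto c F (𝓝 c₀))
    (h : ∀ᶠ k in F, IsViscositySolution H B (l k) (c k) (f k)) :
    IsViscositySolution H B l₀ c₀ f₀ := by
  set A := ∑ i, ∑ j, |B i j| with hA
  have hd : Tendsto (fun k => dist (f k) f₀) F (𝓝 0) := tendsto_iff_dist_tendsto_zero.1 hf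
  have hdl : Tendsto (fun k => |l k - l₀|) F (𝓝 0) := by
    simpa [Real.dist_eq] using tendsto_iff_dist_tendsto_zero.1 hl
  have hdc : Tendsto (fun k => |c k - c₀|) F (𝓝 0) := by
    simpa [Real.dist_eq] using tendsto_iff_dist_tendsto_zero.1 hc
  have hrhs : Tendsto (fun k => |c k - c₀| + A * dist (f k) f₀ + |l k| * dist (f k) f₀ +
      |l k - l₀| * ‖f₀‖) F (𝓝 0) := by
    have := ((hdc.add (hd.const_mul A)).add (hl.abs.mul hd)).add (hdl.mul_const ‖f₀‖)
    simpa using this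
  have key : ∀ ε > 0, ∃ k, IsViscositySolution H B (l k) (c k) (f k) ∧
      (∀ x i, |f k x i - f₀ x i| ≤ ε) ∧ ∀ x i, |(c k - (B.mulVec (f k x) i + l k * f k x i)) -
        (c₀ - (B.mulVec (f₀ x) i + l₀ * f₀ x i))| ≤ ε := by
    intro ε hε
    obtain ⟨k, ⟨hk, h1⟩, h2⟩ := ((h.and (hd.eventually_le_const hε)).and
      (hrhs.eventually_le_const hε)).exists
    refine ⟨k, hk, fun x i => (abs_apply_sub_le_dist _ _ x i).trans h1, fun x i => ?_⟩
    refine le_trans ?_ h2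
    have h3 : (c k - (B.mulVec (f k x) i + l k * f k x i)) -
        (c₀ - (B.mulVec (f₀ x) i + l₀ * f₀ x i)) = (c k - c₀) - B.mulVec (f k x - f₀ x) i -
          l k * (f k x i - f₀ x i) - (l k - l₀) * f₀ x i := by
      rw [Matrix.mulVec_sub, Pi.sub_apply]; ring
    have h4 : |B.mulVec (f k x - f₀ x) i| ≤ A * dist (f k) f₀ :=
      abs_mulVec_le B (fun j => abs_apply_sub_le_dist _ _ x j) i
    have h5 : |l k * (f k x i - f₀ x i)| ≤ |l k| * dist (f k) f₀ := by
      rw [abs_mul]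
      exact mul_le_mul_of_nonneg_left (abs_apply_sub_le_dist _ _ x i) (abs_nonneg _)
    have h6 : |(l k - l₀) * f₀ x i| ≤ |l k - l₀| * ‖f₀‖ := by
      rw [abs_mul]
      exact mul_le_mul_of_nonneg_left ((norm_le_pi_norm (f₀ x) i).trans (f₀.norm_coe_le_norm x))
        (abs_nonneg _)
    rw [h3]
    refine (abs_sub _ _).trans (add_le_add ((abs_sub _ _).trans (add_le_add
      ((abs_sub _ _).trans (add_le_add le_rfl h4)) h5)) h6)
  constructor
  · refine isViscositySubsolution_of_forall_approx H_cont f₀.continuous fun ε hε => ?_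
    obtain ⟨k, h1, h2⟩ := key ε hε
    exact ⟨_, _, _, h1.1, h2⟩
  · refine isViscositySupersolution_of_forall_approx H_cont f₀.continuous fun ε hε => ?_
    obtain ⟨k, h1, h2⟩ := key ε hε
    exact ⟨_, _, _, h1.2, h2⟩

end Compactness

/-! ### The critical system and the vanishing discount -/

section Critical

open BoundedContinuousFunction

variable {n : ℕ} {M : Type*} [TopologicalSpace M] [ChartedSpace (EuclideanSpace ℝ (Fin n)) M]
  {m : ℕ} {H : Fin m → CotangentBundle n M → ℝ} {B : Matrix (Fin m) (Fin m) ℝ} {l c l' c' : ℝ}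
  {u v : M → Fin m → ℝ}

/-- Change of the discount and of the right-hand side. -/
theorem IsViscositySubsolution.mono (hu : IsViscositySubsolution H B l c u)
    (h : ∀ x i, c - l * u x i ≤ c' - l' * u x i) : IsViscositySubsolution H B l' c' u := by
  rw [isViscositySubsolution_iff] at hu ⊢
  exact ⟨hu.1, fun i z hz => (hu.2 i z hz).trans (by linarith [h z.1 i])⟩

theorem IsViscositySupersolution.mono (hu : IsViscositySupersolution H B l c u)
    (h : ∀ x i, c' - l' * u x i ≤ c - l * u x i) : IsViscositySupersolution H B l' c' u := by
  rw [isViscositySupersolution_iff] at hu ⊢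
  exact ⟨hu.1, fun i z hz => le_trans (by linarith [h z.1 i]) (hu.2 i z hz)⟩

variable [IsManifold (𝓡 n) ∞ M] [CompactSpace M]

/-- Comparison with the function `0` bounds `l u`. -/
theorem abs_mul_le_of_isViscositySolution (H_cont : ∀ i, Continuous (H i))
    (H_coer : ∀ i, LocallyCoercive (H i))
    (B_offdiag : ∀ i j, j ≠ i → B i j ≤ 0) (B_rowsum : ∀ i, ∑ j, B i j = 0) {C₀ : ℝ}
    (hC₀ : ∀ (i : Fin m) (x : M), |H i ⟨x, 0⟩| ≤ C₀) (hl : 0 ≤ l)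
    (hu : IsViscositySolution H B l c u) (x : M) (i : Fin m) : |l * u x i| ≤ C₀ + |c| := by
  have h1 : IsViscositySubsolution H B l C₀ (fun (_ : M) _ => 0) :=
    isViscositySubsolution_const B_rowsum fun i x => by linarith [(abs_le.1 (hC₀ i x)).2]
  have h2 : IsViscositySupersolution H B l (-C₀) (fun (_ : M) _ => 0) :=
    isViscositySupersolution_const B_rowsum fun i x => by linarith [(abs_le.1 (hC₀ i x)).1]
  have h3 := mul_sub_le_of_sub_super H_cont H_coer B_offdiag B_rowsum hl h1 hu.2 x i
  have h4 := mul_sub_le_of_sub_super H_cont H_coer B_offdiag B_rowsum hl hu.1 h2 x i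
  rw [abs_le]
  constructor <;> linarith [le_abs_self c, neg_abs_le c]

/-- Existence of a critical value and of a critical solution, as limits of normalized discounted
solutions along a sequence of discounts `d k → 0`. -/
theorem exists_critical_solution [T2Space M] [ConnectedSpace M] (hm : 1 ≤ m)
    (H_cont : ∀ i, Continuous (H i)) (H_coer : ∀ i, LocallyCoercive (H i))
    (B_offdiag : ∀ i j, j ≠ i → B i j ≤ 0) (B_rowsum : ∀ i, ∑ j, B i j = 0)
    (B_irred : ∀ S : Set (Fin m), S.Nonempty → S ≠ univ → ∃ i ∈ S, ∃ j ∉ S, B i j ≠ 0) {C₀ : ℝ}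
    (hC₀ : ∀ (i : Fin m) (x : M), |H i ⟨x, 0⟩| ≤ C₀) :
    ∃ (c : ℝ) (u : M → Fin m → ℝ), IsViscositySolution H B 0 c u := by
  obtain ⟨x₁⟩ : Nonempty M := inferInstance
  set i₁ : Fin m := ⟨0, hm⟩
  set d : ℕ → ℝ := fun k => 1 / ((k : ℝ) + 1) with hlam
  have hlam0 : ∀ k, 0 < d k := fun k => by simp only [hlam]; positivity
  have hex := fun k => exists_isViscositySolution (B := B) H_cont H_coer B_offdiag B_rowsum hC₀
    (hlam0 k) 0
  choose u hu using hex
  have hbound : ∀ k x i, |d k * u k x i| ≤ C₀ := fun k x i => by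
    simpa using abs_mul_le_of_isViscositySolution H_cont H_coer B_offdiag B_rowsum hC₀
      (hlam0 k).le (hu k) x i
  have hlow := fun i => exists_forall_ge_of_locallyCoercive (H_cont i) (H_coer i)
  choose L hL using hlow
  -- `B u ≤ C₁` at the points where the superdifferential is nonempty, hence everywhere
  set C₁ := C₀ + ∑ i, |L i| with hC₁
  have hB : ∀ k x i, B.mulVec (u k x) i ≤ C₁ := by
    intro k x i
    by_contra! hcon
    have hcont : Continuous fun x => B.mulVec (u k x) i :=
      (continuous_apply i).comp (continuous_const.matrix_mulVec (hu k).1.1)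
    obtain ⟨z, hz, hzV⟩ := exists_mem_superjet_fst_mem (n := n)
      ((continuous_apply i).comp (hu k).1.1) x (hcont.continuousAt.eventually_const_lt hcon)
    have h1 := (isViscositySubsolution_iff.1 (hu k).1).2 i z hz
    have h2 : C₁ < B.mulVec (u k z.1) i := hzV
    have h3 := (abs_le.1 (hbound k z.1 i)).1
    have h4 := hL i z
    have h5 := Finset.single_le_sum (f := fun i => |L i|) (fun _ _ => abs_nonneg _)
      (Finset.mem_univ i)
    have h6 := le_abs_self (L i)
    linarith
  obtain ⟨K₁, hK₁⟩ := exists_forall_sub_le_of_mulVec_le B_offdiag B_rowsum B_irred C₁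
  have hdiff : ∀ k x i j, |u k x i - u k x j| ≤ K₁ := fun k x i j => hK₁ _ (hB k x) i j
  set A := ∑ i, ∑ j, |B i j| with hA
  set C₂ := A * K₁ + C₀ with hC₂
  have hH : ∀ k i, ∀ z ∈ superjet n (fun x => u k x i), H i z ≤ C₂ := by
    intro k i z hz
    have h1 := (isViscositySubsolution_iff.1 (hu k).1).2 i z hz
    have h2 := abs_mulVec_le B (w := fun j => u k z.1 j + -u k z.1 i)
      (fun j => by rw [← sub_eq_add_neg]; exact hdiff k z.1 j i) i
    rw [mulVec_add_const B_rowsum] at h2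
    linarith [(abs_le.1 h2).1, (abs_le.1 (hbound k z.1 i)).1]
  have hosc := fun i => exists_forall_abs_sub_le (H_coer i) C₂
  choose K₂ hK₂ using hosc
  set K₃ := K₁ + ∑ i, |K₂ i| with hK₃
  -- the solutions are normalized to vanish at `(x₁, i₁)`, which turns the right-hand side into
  -- `d k * a k`
  set a : ℕ → ℝ := fun k => -u k x₁ i₁ with ha
  have hsol : ∀ k, IsViscositySolution H B (d k) (0 + d k * a k) (fun x i => u k x i + a k) :=
    fun k => (hu k).add_const B_rowsum (a k)
  set f : ℕ → M →ᵇ (Fin m → ℝ) := fun k => mkOfCompact ⟨_, (hsol k).1.1⟩ with hf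
  have hfmem : ∀ k, f k ∈ subsolutionFamily H K₃ C₂ := by
    intro k
    refine ⟨fun x i => ?_, fun i z hz => ?_⟩
    · change |u k x i + -u k x₁ i₁| ≤ K₃
      have h1 := hK₂ i (fun x => u k x i) ((continuous_apply i).comp (hu k).1.1) (hH k i) x x₁
      have h2 := hdiff k x₁ i i₁
      have h3 := Finset.single_le_sum (f := fun i => |K₂ i|) (fun _ _ => abs_nonneg _)
        (Finset.mem_univ i)
      have h4 : u k x i + -u k x₁ i₁ = (u k x i - u k x₁ i) + (u k x₁ i - u k x₁ i₁) := by ring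
      rw [h4]
      exact (abs_add_le _ _).trans (by linarith [le_abs_self (K₂ i)])
    · refine hH k i z ?_
      have hz' : z.2 ∈ superdifferential n (fun x => u k x i + a k) z.1 := hz
      rwa [superdifferential_add_const (fun x => u k x i)] at hz'
  have hcmem : ∀ k, 0 + d k * a k ∈ Metric.closedBall (0 : ℝ) C₀ := by
    intro k
    rw [mem_closedBall_zero_iff, Real.norm_eq_abs, zero_add, ha, mul_neg, abs_neg]
    exact hbound k x₁ i₁
  obtain ⟨⟨f₀, c₀⟩, -, θ, hθ, hlim⟩ :=
    ((isCompact_closure_subsolutionFamily H_coer K₃ C₂).prod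
      (isCompact_closedBall (0 : ℝ) C₀)).tendsto_subseq
      (x := fun k => (f k, 0 + d k * a k)) fun k => ⟨subset_closure (hfmem k), hcmem k⟩
  refine ⟨c₀, f₀, isViscositySolution_of_tendsto H_cont (F := atTop) (f := fun k => f (θ k))
    (l := fun k => d (θ k)) (c := fun k => 0 + d (θ k) * a (θ k)) ?_ ?_ ?_ ?_⟩
  · exact (continuous_fst.tendsto _).comp hlim
  · exact tendsto_one_div_add_atTop_nhds_zero_nat.comp hθ.tendsto_atTop
  · exact (continuous_snd.tendsto _).comp hlim
  · exact Eventually.of_forall fun k => hsol (θ k)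

/-- Approximate concavity in `l` of the discounted solutions: for the intermediate discount, the
convex combination of the solutions exceeds the solution by at most the distance between the two. -/
theorem convex_comb_le_of_isViscositySolution (H_cont : ∀ i, Continuous (H i))
    (H_coer : ∀ i, LocallyCoercive (H i))
    (H_convex : ∀ (i : Fin m) (x : M),
      ConvexOn ℝ univ (fun p : TangentSpace (𝓡 n) x →L[ℝ] ℝ => H i ⟨x, p⟩))
    (B_offdiag : ∀ i j, j ≠ i → B i j ≤ 0) (B_rowsum : ∀ i, ∑ j, B i j = 0) {l₁ l₂ s t D : ℝ}
    {w : M → Fin m → ℝ} (hl₁ : 0 < l₁) (hl₂ : l₁ < l₂) (hs : 0 < s) (ht : 0 < t) (hst : s + t = 1)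
    (hu : IsViscositySolution H B l₁ c u) (hv : IsViscositySolution H B l₂ c v)
    (hw : IsViscositySolution H B (s * l₁ + t * l₂) c w) (hD : ∀ x i, |u x i - v x i| ≤ D)
    (x : M) (i : Fin m) : s * u x i + t * v x i ≤ w x i + D := by
  set l := s * l₁ + t * l₂ with hl
  have hl0 : 0 < l := by have := hl₁.trans hl₂; positivity
  have hcu : ∀ j, Continuous fun x => u x j := fun j => (continuous_apply j).comp hu.1.1
  have hcv : ∀ j, Continuous fun x => v x j := fun j => (continuous_apply j).comp hv.1.1
  have hsub : IsViscositySubsolution H B l (c + l * D) (fun x i => s * u x i + t * v x i) := by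
    rw [isViscositySubsolution_iff]
    refine ⟨continuous_pi fun j => ((hcu j).const_mul s).add ((hcv j).const_mul t),
      fun j z hz => ?_⟩
    refine (le_of_mem_superjet_convex_comb (H_cont j) (H_coer j) (H_convex j) (hcu j) (hcv j)
      (continuous_rhs hu.1.1 B l₁ c j) (continuous_rhs hv.1.1 B l₂ c j)
      ((isViscositySubsolution_iff.1 hu.1).2 j) ((isViscositySubsolution_iff.1 hv.1).2 j)
      hs ht hst z hz).trans ?_
    have h1 : B.mulVec (fun i => s * u z.1 i + t * v z.1 i) j =
        s * B.mulVec (u z.1) j + t * B.mulVec (v z.1) j := by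
      have : (fun i => s * u z.1 i + t * v z.1 i) = s • u z.1 + t • v z.1 := rfl
      rw [this, Matrix.mulVec_add, Matrix.mulVec_smul, Matrix.mulVec_smul]
      rfl
    rw [h1]
    -- the defect is `s (l - l₁) (u - v)`, because `s (l - l₁) = t (l₂ - l)`
    have h2 : s * (l - l₁) = t * (l₂ - l) := by
      have : t = 1 - s := by linarith
      rw [hl, this]; ring
    have h3 : 0 ≤ s * (l - l₁) := by
      have : l - l₁ = t * (l₂ - l₁) := by
        have : s = 1 - t := by linarith
        rw [hl, this]; ring
      rw [this]
      have := sub_pos.2 hl₂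
      positivity
    have h4 : s * (l - l₁) ≤ l := by nlinarith
    have hDz := (abs_le.1 (hD z.1 j)).2
    have hD0 : 0 ≤ D := (abs_nonneg _).trans (hD z.1 j)
    have h5 : s * (l - l₁) * (u z.1 j - v z.1 j) ≤ l * D :=
      (mul_le_mul_of_nonneg_left hDz h3).trans (mul_le_mul_of_nonneg_right h4 hD0)
    have h6 : s * (c - (B.mulVec (u z.1) j + l₁ * u z.1 j)) +
        t * (c - (B.mulVec (v z.1) j + l₂ * v z.1 j)) = (s + t) * c -
        (s * B.mulVec (u z.1) j + t * B.mulVec (v z.1) j) - l * (s * u z.1 j + t * v z.1 j) +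
        (s * (l - l₁) * u z.1 j - t * (l₂ - l) * v z.1 j) := by ring
    rw [h6, hst, ← h2]
    linarith
  have h := mul_sub_le_of_sub_super H_cont H_coer B_offdiag B_rowsum hl0.le hsub hw.2 x i
  have h7 : l * (s * u x i + t * v x i - w x i) ≤ l * D := by linarith
  linarith [le_of_mul_le_mul_left h7 hl0]

/-- Any two limit points of the discounted solutions as the discount vanishes are ordered, hence
equal by symmetry: `g` is approximated at a discount `l` between two discounts at which `f` is
approximated. -/
theorem le_of_mapClusterPt (H_cont : ∀ i, Continuous (H i))
    (H_coer : ∀ i, LocallyCoercive (H i))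
    (H_convex : ∀ (i : Fin m) (x : M),
      ConvexOn ℝ univ (fun p : TangentSpace (𝓡 n) x →L[ℝ] ℝ => H i ⟨x, p⟩))
    (B_offdiag : ∀ i j, j ≠ i → B i j ≤ 0) (B_rowsum : ∀ i, ∑ j, B i j = 0)
    {U : ℝ → M →ᵇ (Fin m → ℝ)} (hU : ∀ l, 0 < l → IsViscositySolution H B l c (U l))
    {f g : M →ᵇ (Fin m → ℝ)} (hf : MapClusterPt f (𝓝[>] 0) U) (hg : MapClusterPt g (𝓝[>] 0) U)
    (x : M) (i : Fin m) : f x i ≤ g x i := by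
  refine le_of_forall_pos_le_add fun ε hε => ?_
  set η := ε / 4 with hη
  have hη0 : 0 < η := by positivity
  have hfr : ∀ {h : M →ᵇ (Fin m → ℝ)}, MapClusterPt h (𝓝[>] 0) U → ∀ b > 0, ∃ l, 0 < l ∧ l < b ∧
      dist (U l) h < η := by
    intro h hh b hb
    have h1 := (mapClusterPt_iff_frequently.1 hh) (Metric.ball h η) (Metric.ball_mem_nhds h hη0)
    obtain ⟨l, hl, hl2⟩ := (h1.and_eventually (Ioo_mem_nhdsGT hb)).exists
    exact ⟨l, hl2.1, hl2.2, hl⟩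
  -- discounts `l₁ < l < l₂`, chosen from the largest to the smallest
  obtain ⟨l₂, hl₂, -, hd₂⟩ := hfr hf 1 one_pos
  obtain ⟨l, hl, hl', hd⟩ := hfr hg l₂ hl₂
  obtain ⟨l₁, hl₁, hl₁', hd₁⟩ := hfr hf l hl
  have hne : 0 < l₂ - l₁ := by linarith
  set s := (l₂ - l) / (l₂ - l₁) with hs
  set t := (l - l₁) / (l₂ - l₁) with ht
  have hs0 : 0 < s := div_pos (by linarith) hne
  have ht0 : 0 < t := div_pos (by linarith) hne
  have hst : s + t = 1 := by rw [hs, ht, ← add_div, div_eq_one_iff_eq hne.ne']; ring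
  have hcomb : s * l₁ + t * l₂ = l := by rw [hs, ht]; field_simp; ring
  have hD : ∀ x i, |U l₁ x i - U l₂ x i| ≤ 2 * η := fun x i =>
    (abs_apply_sub_le_dist _ _ x i).trans (by
      have := dist_triangle_right (U l₁) (U l₂) f
      linarith)
  have key := convex_comb_le_of_isViscositySolution H_cont H_coer H_convex B_offdiag B_rowsum
    hl₁ (hl₁'.trans hl') hs0 ht0 hst (hU l₁ hl₁) (hU l₂ hl₂) (by rw [hcomb]; exact hU l hl) hD x i
  have h1 := (abs_le.1 (abs_apply_sub_le_dist (U l₁) f x i)).1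
  have h2 := (abs_le.1 (abs_apply_sub_le_dist (U l₂) f x i)).1
  have h3 := (abs_le.1 (abs_apply_sub_le_dist (U l) g x i)).2
  have h4 : f x i - η ≤ s * U l₁ x i + t * U l₂ x i := by
    have h5 : s * (f x i - η) + t * (f x i - η) = f x i - η := by rw [← add_mul, hst, one_mul]
    rw [← h5]
    exact add_le_add (mul_le_mul_of_nonneg_left (by linarith) hs0.le)
      (mul_le_mul_of_nonneg_left (by linarith) ht0.le)
  linarith

end Critical

/-! ### Normalization by the minimum -/

section Normalization

theorem tendstoUniformly_iff_forall_abs_sub_le {ι M : Type*} {m : ℕ} {F : ι → M → Fin m → ℝ}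
    {f : M → Fin m → ℝ} {p : Filter ι} :
    TendstoUniformly F f p ↔ ∀ ε > 0, ∀ᶠ k in p, ∀ x i, |F k x i - f x i| ≤ ε := by
  rw [Metric.tendstoUniformly_iff]
  refine ⟨fun h ε hε => (h ε hε).mono fun k hk x i => ?_, fun h ε hε =>
    (h (ε / 2) (half_pos hε)).mono fun k hk x => ?_⟩
  · rw [← Real.dist_eq, dist_comm]
    exact (dist_le_pi_dist _ _ i).trans (hk x).le
  · refine lt_of_le_of_lt ((dist_pi_le_iff (half_pos hε).le).2 fun i => ?_) (half_lt_self hε)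
    rw [dist_comm, Real.dist_eq]
    exact hk x i

variable {M : Type*} [Nonempty M] {m : ℕ} [Nonempty (Fin m)] {u v : M → Fin m → ℝ} {K D : ℝ}

/-- The bound `K` keeps the infima over `M` from being junk values. -/
theorem iInf_iInf_le_add (hu : ∀ x i, |u x i| ≤ K) (h : ∀ x i, u x i ≤ v x i + D) :
    ⨅ i, ⨅ x, u x i ≤ (⨅ i, ⨅ x, v x i) + D := by
  rw [← sub_le_iff_le_add]
  refine le_ciInf fun i => le_ciInf fun x => ?_
  have h1 : ⨅ i, ⨅ x, u x i ≤ ⨅ x, u x i := ciInf_le (finite_range _).bddBelow i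
  have h2 : ⨅ x, u x i ≤ u x i :=
    ciInf_le ⟨-K, forall_mem_range.2 fun y => (abs_le.1 (hu y i)).1⟩ x
  linarith [h x i]

theorem abs_iInf_iInf_sub_le (hu : ∀ x i, |u x i| ≤ K) (h : ∀ x i, |u x i - v x i| ≤ D) :
    |(⨅ i, ⨅ x, u x i) - ⨅ i, ⨅ x, v x i| ≤ D := by
  have hv : ∀ x i, |v x i| ≤ K + D := fun x i => by
    have := abs_sub_abs_le_abs_sub (v x i) (u x i)
    rw [abs_sub_comm] at this
    linarith [hu x i, h x i]
  rw [abs_le]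
  constructor
  · have := iInf_iInf_le_add (D := D) hv (v := u) fun x i => by linarith [(abs_le.1 (h x i)).1]
    linarith
  · have := iInf_iInf_le_add (D := D) hu (v := v) fun x i => by linarith [(abs_le.1 (h x i)).2]
    linarith

/-- The normalization is Lipschitz for the uniform distance. -/
theorem abs_normalizeMin_sub_le (hu : ∀ x i, |u x i| ≤ K) (h : ∀ x i, |u x i - v x i| ≤ D) (x : M)
    (i : Fin m) : |normalizeMin u x i - normalizeMin v x i| ≤ D + D := by
  have h1 : normalizeMin u x i - normalizeMin v x i =
      (u x i - v x i) - ((⨅ i, ⨅ x, u x i) - ⨅ i, ⨅ x, v x i) := by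
    simp only [normalizeMin]; ring
  rw [h1]
  exact (abs_sub _ _).trans (add_le_add (h x i) (abs_iInf_iInf_sub_le hu h))

theorem normalizeMin_add_const (hu : ∀ x i, |u x i| ≤ K) (a : ℝ) :
    normalizeMin (fun x i => u x i + a) = normalizeMin u := by
  have hu' : ∀ x i, |u x i + a| ≤ K + |a| := fun x i =>
    (abs_add_le _ _).trans (by linarith [hu x i])
  have h1 : ⨅ i, ⨅ x, u x i ≤ (⨅ i, ⨅ x, (u x i + a)) + -a :=
    iInf_iInf_le_add hu fun x i => by linarith
  have h2 : ⨅ i, ⨅ x, (u x i + a) ≤ (⨅ i, ⨅ x, u x i) + a :=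
    iInf_iInf_le_add hu' fun x i => le_rfl
  ext x i
  simp only [normalizeMin]
  linarith

end Normalization

/-! ### Convergence of the discounted solutions -/

section VanishingDiscount

open BoundedContinuousFunction

variable {n : ℕ} {M : Type*} [TopologicalSpace M] [ChartedSpace (EuclideanSpace ℝ (Fin n)) M]
  {m : ℕ} {H : Fin m → CotangentBundle n M → ℝ} {B : Matrix (Fin m) (Fin m) ℝ} {l c c' : ℝ}
  {u v : M → Fin m → ℝ}

variable [IsManifold (𝓡 n) ∞ M] [CompactSpace M]

theorem IsViscositySolution.eq (H_cont : ∀ i, Continuous (H i))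
    (H_coer : ∀ i, LocallyCoercive (H i))
    (B_offdiag : ∀ i j, j ≠ i → B i j ≤ 0) (B_rowsum : ∀ i, ∑ j, B i j = 0) (hl : 0 < l)
    (hu : IsViscositySolution H B l c u) (hv : IsViscositySolution H B l c v) : u = v := by
  ext x i
  have h1 := mul_sub_le_of_sub_super H_cont H_coer B_offdiag B_rowsum hl.le hu.1 hv.2 x i
  have h2 := mul_sub_le_of_sub_super H_cont H_coer B_offdiag B_rowsum hl.le hv.1 hu.2 x i
  rw [sub_self] at h1 h2
  have h3 : u x i - v x i ≤ 0 := nonpos_of_mul_nonpos_right h1 hl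
  have h4 : v x i - u x i ≤ 0 := nonpos_of_mul_nonpos_right h2 hl
  linarith

theorem IsViscositySolution.critical_value_eq [Nonempty M] (hm : 1 ≤ m)
    (H_cont : ∀ i, Continuous (H i)) (H_coer : ∀ i, LocallyCoercive (H i))
    (B_offdiag : ∀ i j, j ≠ i → B i j ≤ 0) (B_rowsum : ∀ i, ∑ j, B i j = 0)
    (hu : IsViscositySolution H B 0 c u) (hv : IsViscositySolution H B 0 c' v) : c = c' := by
  obtain ⟨x⟩ : Nonempty M := inferInstance
  have h1 := mul_sub_le_of_sub_super H_cont H_coer B_offdiag B_rowsum le_rfl hu.1 hv.2 x ⟨0, hm⟩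
  have h2 := mul_sub_le_of_sub_super H_cont H_coer B_offdiag B_rowsum le_rfl hv.1 hu.2 x ⟨0, hm⟩
  linarith

/-- Bound on the discounted solutions at the critical right-hand side: subtracting a large constant
from a critical solution gives a discounted subsolution, adding it a supersolution. -/
theorem IsViscositySolution.abs_le_of_critical (H_cont : ∀ i, Continuous (H i))
    (H_coer : ∀ i, LocallyCoercive (H i))
    (B_offdiag : ∀ i j, j ≠ i → B i j ≤ 0) (B_rowsum : ∀ i, ∑ j, B i j = 0) {K : ℝ} (hl : 0 < l)
    (hu : IsViscositySolution H B l c u) (hv : IsViscositySolution H B 0 c v)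
    (hK : ∀ x i, |v x i| ≤ K) (x : M) (i : Fin m) : |u x i| ≤ 2 * K := by
  have hsub : IsViscositySubsolution H B l c (fun x i => v x i + -K) :=
    (IsViscositySubsolution.add_const B_rowsum hv.1 (-K)).mono fun x i => by
      have := mul_nonneg hl.le (by linarith [(abs_le.1 (hK x i)).2] : 0 ≤ K - v x i)
      linarith
  have hsuper : IsViscositySupersolution H B l c (fun x i => v x i + K) :=
    (IsViscositySupersolution.add_const B_rowsum hv.2 K).mono fun x i => by
      have := mul_nonneg hl.le (by linarith [(abs_le.1 (hK x i)).1] : 0 ≤ K + v x i)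
      linarith
  have h1 := mul_sub_le_of_sub_super H_cont H_coer B_offdiag B_rowsum hl.le hsub hu.2 x i
  have h2 := mul_sub_le_of_sub_super H_cont H_coer B_offdiag B_rowsum hl.le hu.1 hsuper x i
  rw [sub_self] at h1 h2
  have h3 := nonpos_of_mul_nonpos_right h1 hl
  have h4 := nonpos_of_mul_nonpos_right h2 hl
  have h5 := abs_le.1 (hK x i)
  rw [abs_le]
  constructor <;> linarith

/-- Bounded discounted solutions converge as the discount vanishes: they stay in a compact set, and
`le_of_mapClusterPt` leaves only one limit point. -/
theorem exists_tendsto_of_isViscositySolution (H_cont : ∀ i, Continuous (H i))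
    (H_coer : ∀ i, LocallyCoercive (H i))
    (H_convex : ∀ (i : Fin m) (x : M),
      ConvexOn ℝ univ (fun p : TangentSpace (𝓡 n) x →L[ℝ] ℝ => H i ⟨x, p⟩))
    (B_offdiag : ∀ i j, j ≠ i → B i j ≤ 0) (B_rowsum : ∀ i, ∑ j, B i j = 0) {K : ℝ} (hK0 : 0 ≤ K)
    {U : ℝ → M →ᵇ (Fin m → ℝ)} (hU : ∀ l, 0 < l → IsViscositySolution H B l c (U l))
    (hK : ∀ l, 0 < l → ∀ x i, |U l x i| ≤ K) :
    ∃ f : M →ᵇ (Fin m → ℝ), Tendsto U (𝓝[>] 0) (𝓝 f) ∧ IsViscositySolution H B 0 c f := by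
  set C := |c| + (∑ i, ∑ j, |B i j|) * K + K with hC
  have hmem : ∀ᶠ l in 𝓝[>] (0 : ℝ), U l ∈ closure (subsolutionFamily H K C) := by
    filter_upwards [Ioo_mem_nhdsGT (one_pos : (0 : ℝ) < 1)] with l hl
    refine subset_closure ⟨hK l hl.1, fun i z hz => ?_⟩
    have h1 := (hU l hl.1).1.exists_forall_le hl.1.le (hK l hl.1) i z hz
    have h2 : l * K ≤ K := mul_le_of_le_one_left hK0 hl.2.le
    linarith
  have hcpt := isCompact_closure_subsolutionFamily H_coer K C
  obtain ⟨f, -, hf⟩ := hcpt.exists_mapClusterPt_of_frequently hmem.frequently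
  have hlim : Tendsto U (𝓝[>] 0) (𝓝 f) := by
    refine hcpt.tendsto_nhds_of_unique_mapClusterPt hmem fun g _ hg => ?_
    ext x i
    exact le_antisymm
      (le_of_mapClusterPt H_cont H_coer H_convex B_offdiag B_rowsum hU hg hf x i)
      (le_of_mapClusterPt H_cont H_coer H_convex B_offdiag B_rowsum hU hf hg x i)
  refine ⟨f, hlim, isViscositySolution_of_tendsto H_cont hlim (l := fun l => l) (c := fun _ => c)
    (tendsto_id.mono_left nhdsWithin_le_nhds) tendsto_const_nhds ?_⟩
  filter_upwards [self_mem_nhdsWithin] with l hl using hU l hl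

end VanishingDiscount

theorem theorem2
    -- `M` is a compact connected Riemannian manifold without boundary
    {n : ℕ} {M : Type*} [TopologicalSpace M] [T2Space M] [CompactSpace M] [ConnectedSpace M]
    [ChartedSpace (EuclideanSpace ℝ (Fin n)) M] [IsManifold (𝓡 n) ∞ M]
    [RiemannianBundle (fun x : M => TangentSpace (𝓡 n) x)]
    [IsContMDiffRiemannianBundle (𝓡 n) ∞ (EuclideanSpace ℝ (Fin n))
      (fun x : M => TangentSpace (𝓡 n) x)]
    {m : ℕ} (hm : 1 ≤ m)
    -- the Hamiltonians: continuous, convex and coercive in the momentum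
    (H : Fin m → CotangentBundle n M → ℝ)
    (H_cont : ∀ i, Continuous (H i))
    (H_convex : ∀ (i : Fin m) (x : M),
      ConvexOn ℝ univ (fun p : TangentSpace (𝓡 n) x →L[ℝ] ℝ => H i ⟨x, p⟩))
    (H_coercive : ∀ i : Fin m, ∃ α β : ℝ → ℝ, Tendsto α atTop atTop ∧ Tendsto β atTop atTop ∧
      ∀ (x : M) (p : TangentSpace (𝓡 n) x →L[ℝ] ℝ), α ‖p‖ ≤ H i ⟨x, p⟩ ∧ H i ⟨x, p⟩ ≤ β ‖p‖)
    -- the coupling matrix: sign condition, zero row sums, irreducibility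
    (B : Matrix (Fin m) (Fin m) ℝ)
    (B_offdiag : ∀ i j, j ≠ i → B i j ≤ 0)
    (B_rowsum : ∀ i, ∑ j, B i j = 0)
    (B_irred : ∀ S : Set (Fin m), S.Nonempty → S ≠ univ → ∃ i ∈ S, ∃ j ∉ S, B i j ≠ 0) :
    ∃ (cH : ℝ) (u₀ : M → Fin m → ℝ),
      -- `cH` is the critical value
      (∀ c : ℝ, (∃ u, IsViscositySolution H B 0 c u) ↔ c = cH) ∧
      -- the discounted systems are uniquely solvable
      (∀ l : ℝ, 0 < l → ∀ c : ℝ, ∃! u, IsViscositySolution H B l c u) ∧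
      -- `u₀` is the critical solution which is the limit of the discounted solutions for `c = cH`
      IsViscositySolution H B 0 cH u₀ ∧
      ∀ U : ℝ → ℝ → M → Fin m → ℝ,
        (∀ l : ℝ, 0 < l → ∀ c : ℝ, IsViscositySolution H B l c (U l c)) →
        TendstoUniformly (fun l => U l cH) u₀ (𝓝[>] 0) ∧
        ∀ c : ℝ,
          TendstoUniformly (fun (l : ℝ) (x : M) (i : Fin m) => l * U l c x i)
            (fun _ _ => c - cH) (𝓝[>] 0) ∧
          TendstoUniformly (fun l => normalizeMin (U l c)) (normalizeMin u₀) (𝓝[>] 0) := by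
  have : Nonempty (Fin m) := ⟨⟨0, hm⟩⟩
  choose α β hα _ hαβ using H_coercive
  have H_coer : ∀ i, LocallyCoercive (H i) := fun i =>
    locallyCoercive_of_tendsto (hα i) fun x p => (hαβ i x p).1
  set C₀ := ∑ i, (|α i 0| + |β i 0|)
  have hC₀ : ∀ (i : Fin m) (x : M), |H i ⟨x, 0⟩| ≤ C₀ := fun i x => by
    have h1 := Finset.single_le_sum (f := fun i => |α i 0| + |β i 0|)
      (fun _ _ => add_nonneg (abs_nonneg _) (abs_nonneg _)) (Finset.mem_univ i)
    have h0 : ‖(0 : TangentSpace (𝓡 n) x →L[ℝ] ℝ)‖ = 0 := ContinuousLinearMap.opNorm_zero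
    have h2 := hαβ i x 0
    rw [h0] at h2
    refine le_trans ?_ h1
    rw [abs_le]
    constructor <;> linarith [neg_abs_le (α i 0), le_abs_self (β i 0), abs_nonneg (α i 0),
      abs_nonneg (β i 0)]
  obtain ⟨cH, w, hw⟩ :=
    exists_critical_solution hm H_cont H_coer B_offdiag B_rowsum B_irred hC₀
  have hex : ∀ l : ℝ, 0 < l → ∀ c : ℝ, ∃ u, IsViscositySolution H B l c u := fun l hl c =>
    exists_isViscositySolution H_cont H_coer B_offdiag B_rowsum hC₀ hl c
  have huniq : ∀ {l : ℝ}, 0 < l → ∀ {c : ℝ} {u v : M → Fin m → ℝ},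
      IsViscositySolution H B l c u → IsViscositySolution H B l c v → u = v :=
    fun hl _ _ _ hu hv => hu.eq H_cont H_coer B_offdiag B_rowsum hl hv
  -- the solutions for `c = cH`, bounded uniformly in the discount by the critical solution `w`
  obtain ⟨K, hK0, hK⟩ : ∃ K : ℝ, 0 ≤ K ∧ ∀ x i, |w x i| ≤ K :=
    ⟨‖BoundedContinuousFunction.mkOfCompact ⟨w, hw.1.1⟩‖, norm_nonneg _, fun x i =>
      (norm_le_pi_norm (w x) i).trans
        ((BoundedContinuousFunction.mkOfCompact ⟨w, hw.1.1⟩).norm_coe_le_norm x)⟩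
  have hV : ∀ l : ℝ, ∃ V : BoundedContinuousFunction M (Fin m → ℝ),
      0 < l → IsViscositySolution H B l cH V := fun l => by
    by_cases hl : 0 < l
    · obtain ⟨u, hu⟩ := hex l hl cH
      exact ⟨BoundedContinuousFunction.mkOfCompact ⟨u, hu.1.1⟩, fun _ => hu⟩
    · exact ⟨0, fun h => absurd h hl⟩
  choose V hV using hV
  have hVK : ∀ l, 0 < l → ∀ x i, |V l x i| ≤ 2 * K := fun l hl =>
    (hV l hl).abs_le_of_critical H_cont H_coer B_offdiag B_rowsum hl hw hK
  obtain ⟨f, hlim, hf⟩ := exists_tendsto_of_isViscositySolution H_cont H_coer H_convex B_offdiag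
    B_rowsum (by positivity) hV hVK
  have hVf : ∀ ε > 0, ∀ᶠ l in 𝓝[>] (0 : ℝ), ∀ x i, |V l x i - f x i| ≤ ε := fun ε hε => by
    filter_upwards [(tendsto_iff_dist_tendsto_zero.1 hlim).eventually_le_const hε] with l hl x i
    exact (abs_apply_sub_le_dist _ _ x i).trans hl
  refine ⟨cH, f, fun c => ⟨fun ⟨u, hu⟩ => hu.critical_value_eq hm H_cont H_coer B_offdiag
    B_rowsum hw, fun h => ⟨w, h ▸ hw⟩⟩, fun l hl c => ?_, hf, fun U hU => ?_⟩
  · obtain ⟨u, hu⟩ := hex l hl c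
    exact ⟨u, hu, fun v hv => huniq hl hv hu⟩
  -- a change of the right-hand side only adds a constant to the solution
  have hUV : ∀ l, 0 < l → ∀ c, U l c = fun x i => V l x i + (c - cH) / l := fun l hl c => by
    refine huniq hl (hU l hl c) ?_
    have h := (hV l hl).add_const B_rowsum ((c - cH) / l)
    rwa [mul_div_cancel₀ _ hl.ne', add_sub_cancel] at h
  refine ⟨?_, fun c => ⟨?_, ?_⟩⟩ <;> rw [tendstoUniformly_iff_forall_abs_sub_le] <;> intro ε hε
  · filter_upwards [hVf ε hε, self_mem_nhdsWithin] with l h hl x i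
    simpa [hUV l hl cH] using h x i
  · have h0 : Tendsto (fun l : ℝ => l * (2 * K)) (𝓝[>] 0) (𝓝 0) := by
      simpa using (tendsto_id.mono_left nhdsWithin_le_nhds : Tendsto id (𝓝[>] (0 : ℝ)) _).mul_const
        (2 * K)
    filter_upwards [h0.eventually_le_const hε, self_mem_nhdsWithin] with l h hl x i
    have hl' : 0 < l := hl
    have h1 : l * U l c x i - (c - cH) = l * V l x i := by
      rw [hUV l hl c]; field_simp; ring
    rw [h1, abs_mul, abs_of_pos hl']
    exact (mul_le_mul_of_nonneg_left (hVK l hl x i) hl'.le).trans h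
  · filter_upwards [hVf (ε / 2) (half_pos hε), self_mem_nhdsWithin] with l h hl x i
    rw [hUV l hl c, normalizeMin_add_const (hVK l hl)]
    simpa using abs_normalizeMin_sub_le (hVK l hl) h x i
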